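/- A Fano $4$-polyhedron is a convex polytope $P\subset\mathbb R^4$ (the convex hull of a finite set) such that: (i) all vertices of $P$ lie in $\mathbb Z^4$; (ii) $0$ lies in the interior of $P$; (iii) every proper face of $P$ is a simplex; (iv) the vertices of every $3$-dimensional face of $P$ form a $\mathbb Z$-basis of $\mathbb Z^4$. For a proper face $F$ of $P$ let $\sigma(F)$ be the cone of all nonnegative real linear combinations of the vertices of $F$, and let $\Sigma(P)$ be the fan consisting of $\{0\}$ and of all cones $\sigma(F)$, where $F$ runs over the nonempty proper faces of $P$. A set $C$ of vertices of $P$ is a primitive collection if $C$ is contained in no cone of $\Sigma(P)$, while every proper subset of $C$ is contained in some cone of $\Sigma(P)$. The valence of a vertex $v$ of $P$ is the number of vertices of $P$ that are joined to $v$ by an edge ($1$-dimensional face) of $P$, and $P$ is $2$-neighbourly if any two distinct vertices of $P$ are joined by an edge of $P$. Let $P$ be a Fano $4$-polyhedron. If every vertex of $P$ has valence at least $7$, then there is a primitive collection consisting of exactly two vertices of $P$; equivalently, $P$ is not $2$-neighbourly. (For every Fano $4$-polyhedron, whatever the valences of its vertices, a primitive collection with exactly two elements exists if and only if $P$ is not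 $2$-neighbourly.) -/

import Mathlib

/-- A convex polytope in `ℝ^d`: the convex hull of a finite set of points. -/
def IsConvexPolytope {d : ℕ} (P : Set (Fin d → ℝ)) : Prop :=
  ∃ S : Set (Fin d → ℝ), S.Finite ∧ P = convexHull ℝ S

/-- The set of vertices of a polytope, or of one of its faces. -/
def vertexSet {d : ℕ} (P : Set (Fin d → ℝ)) : Set (Fin d → ℝ) :=
  P.extremePoints ℝ

/-- Nonempty faces of a polytope `P`: the sets of points of `P` at which some linear functional
attains its maximum over `P` (the zero functional gives `P` itself). -/
def IsFace {d : ℕ} (P F : Set (Fin d → ℝ)) : Prop :=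
  F.Nonempty ∧ IsExposed ℝ P F

/-- Nonempty faces different from the polytope. -/
def IsProperFace {d : ℕ} (P F : Set (Fin d → ℝ)) : Prop :=
  IsFace P F ∧ F ≠ P

/-- The dimension of (the affine span of) a set. -/
noncomputable def faceDim {d : ℕ} (F : Set (Fin d → ℝ)) : ℕ :=
  Module.finrank ℝ (vectorSpan ℝ F)

/-- A simplex: the convex hull of its vertices, these being affinely independent. -/
def IsSimplex {d : ℕ} (F : Set (Fin d → ℝ)) : Prop :=
  AffineIndependent ℝ ((↑) : vertexSet F → (Fin d → ℝ)) ∧ F = convexHull ℝ (vertexSet F)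

/-- Fano polyhedra of dimension `d`. -/
structure IsFanoPolyhedron {d : ℕ} (P : Set (Fin d → ℝ)) : Prop where
  isConvexPolytope : IsConvexPolytope P
  /-- the vertices are lattice points -/
  vertex_integral : ∀ v ∈ vertexSet P, ∃ z : Fin d → ℤ, v = fun i => (z i : ℝ)
  zero_mem_interior : (0 : Fin d → ℝ) ∈ interior P
  simplicial : ∀ F, IsProperFace P F → IsSimplex F
  /-- the vertices of each facet are the rows of an integral matrix of determinant `±1`,
  that is, they form a `ℤ`-basis of `ℤ^d` -/
  facet_basis : ∀ F, IsProperFace P F → faceDim F + 1 = d →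
    ∃ A : Matrix (Fin d) (Fin d) ℤ, (A.det = 1 ∨ A.det = -1) ∧
      vertexSet F = Set.range (fun i : Fin d => fun j : Fin d => (A i j : ℝ))

/-- The cone `σ(F)` of all nonnegative real linear combinations of the vertices of `F`. -/
def faceCone {d : ℕ} (F : Set (Fin d → ℝ)) : PointedCone ℝ (Fin d → ℝ) :=
  PointedCone.hull ℝ (vertexSet F)

/-- The polyhedral fan `Σ(P)`: the zero cone and the cones over all proper faces. -/
def polyhedralFan {d : ℕ} (P : Set (Fin d → ℝ)) : Set (PointedCone ℝ (Fin d → ℝ)) :=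
  {⊥} ∪ {σ | ∃ F, IsProperFace P F ∧ σ = faceCone F}

/-- Primitive collections: sets of vertices that lie in no cone of the fan, while each proper
subset lies in some cone of the fan. -/
structure IsPrimitiveCollection {d : ℕ} (P C : Set (Fin d → ℝ)) : Prop where
  subset_vertexSet : C ⊆ vertexSet P
  not_subset_cone : ∀ σ ∈ polyhedralFan P, ¬ C ⊆ (σ : Set (Fin d → ℝ))
  proper_subset_cone : ∀ D, D ⊂ C → ∃ σ ∈ polyhedralFan P, D ⊆ (σ : Set (Fin d → ℝ))

/-- `v` and `w` are joined by an edge of `P`: the segment between them is a 1-dimensional face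
(in particular `v ≠ w`). -/
def JoinedByEdge {d : ℕ} (P : Set (Fin d → ℝ)) (v w : Fin d → ℝ) : Prop :=
  IsFace P (segment ℝ v w) ∧ faceDim (segment ℝ v w) = 1

/-- The valence of `v` in `P`: the number of vertices of `P` joined to `v` by an edge. -/
noncomputable def valence {d : ℕ} (P : Set (Fin d → ℝ)) (v : Fin d → ℝ) : ℕ :=
  {w | w ∈ vertexSet P ∧ JoinedByEdge P v w}.ncard

/-- `P` is 2-neighbourly: any two distinct vertices are joined by an edge. -/
def IsTwoNeighbourly {d : ℕ} (P : Set (Fin d → ℝ)) : Prop :=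
  ∀ v ∈ vertexSet P, ∀ w ∈ vertexSet P, v ≠ w → JoinedByEdge P v w

/-!
A vertex of valence at least `7` forces at least `8` vertices, whereas a 2-neighbourly Fano
`4`-polyhedron has at most `7`: if two distinct vertices `v`, `w` are always joined by an edge,
then `v + w` is neither `0` nor a vertex, and `v + w = x + y` for no other vertices `x`, `y`.

To count the vertices, take a facet whose cone contains the sum of all vertices (a special facet
in the sense of Øbro) and sort the vertices by their height, the integral functional equal to `1`
on the facet. Besides the `4` vertices of height `1`, all heights are nonpositive, and they add up
to at least `-4`. Vertices of height `0` have coordinates at least `-1` in the basis given by the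
facet, no two of them are negative at the same index, and each is negative at two indices; so
there are at most two of them. If there are none, one or two of them, then comparison with the
adjacent facets leaves room for at most three, two or one vertices of negative height,
respectively.

A pair of vertices is a primitive collection exactly when it is not an edge: tilting the
functional that defines a simplicial facet shows that any two vertices of a common face are joined
by an edge.
-/

section Combinatorics

open Finset Module

variable {ι M : Type*} [Fintype ι] [AddCommGroup M] {V : Finset M} {b b' : Basis ι ℤ M}
  {i j : ι} {u v w x y : M}

/-- The sum of the coordinates in the basis `b`: the integral functional that takes the value `1`
on `b`, so that the facet spanned by `b` lies on its level set `1`. -/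
noncomputable def height (b : Basis ι ℤ M) : M →ₗ[ℤ] ℤ := ∑ i, b.coord i

lemma height_apply (b : Basis ι ℤ M) (v : M) : height b v = ∑ i, b.repr v i := by
  simp [height]

@[simp]
lemma height_basis (b : Basis ι ℤ M) (i : ι) : height b (b i) = 1 := by
  classical simp [height_apply, Finsupp.single_apply]

lemma eq_zero_of_repr_nonneg (hv : ∀ i, 0 ≤ b.repr v i) (h : height b v ≤ 0) : v = 0 := by
  rw [height_apply] at h
  have hsum := (sum_eq_zero_iff_of_nonneg fun i _ => hv i).1
    (h.antisymm (sum_nonneg fun i _ => hv i))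
  exact b.ext_elem fun i => by simpa using hsum i (mem_univ i)

lemma eq_zero_or_eq_basis_of_repr_nonneg (hv : ∀ i, 0 ≤ b.repr v i) (h : height b v ≤ 1) :
    v = 0 ∨ ∃ j, v = b j := by
  classical
  by_cases hpos : ∃ j, 0 < b.repr v j
  · obtain ⟨j, hj⟩ := hpos
    refine .inr ⟨j, sub_eq_zero.1 (eq_zero_of_repr_nonneg (b := b) (fun i => ?_) ?_)⟩
    · rcases eq_or_ne j i with rfl | hji
      · simpa using Int.add_one_le_of_lt hj
      · simpa [hji] using hv i
    · simpa using h
  · push Not at hpos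
    exact .inl (b.ext_elem fun i => by simpa using (hpos i).antisymm (hv i))

/-- The basis `b` consists of the vertices of a facet of the polytope with vertex set `V`: it is
contained in `V`, and all other elements of `V` lie strictly below the facet. -/
structure IsFacetBasis (V : Finset M) (b : Basis ι ℤ M) : Prop where
  mem : ∀ i, b i ∈ V
  height_nonpos : ∀ v ∈ V, (∀ i, v ≠ b i) → height b v ≤ 0

lemma IsFacetBasis.height_le_one (hb : IsFacetBasis V b) (hv : v ∈ V) : height b v ≤ 1 := by
  by_cases h : ∃ i, v = b i
  · obtain ⟨i, rfl⟩ := h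
    simp
  · exact (hb.height_nonpos v hv (not_exists.1 h)).trans zero_le_one

lemma IsFacetBasis.exists_eq_of_height_pos (hb : IsFacetBasis V b) (hv : v ∈ V)
    (h : 0 < height b v) : ∃ i, v = b i := by
  by_contra! hne
  exact h.not_ge (hb.height_nonpos v hv hne)

/-- The facets spanned by `b` and `b'` are adjacent: `b'` is obtained from `b` by replacing the
single vertex `b i`. -/
structure IsAdjacent (V : Finset M) (b b' : Basis ι ℤ M) (i : ι) : Prop where
  left : IsFacetBasis V b
  right : IsFacetBasis V b'
  ne : b' i ≠ b i
  eq_of_ne : ∀ j, j ≠ i → b' j = b j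

namespace IsAdjacent

lemma symm (h : IsAdjacent V b b' i) : IsAdjacent V b' b i :=
  ⟨h.right, h.left, h.ne.symm, fun j hj => (h.eq_of_ne j hj).symm⟩

lemma height_new_nonpos (h : IsAdjacent V b b' i) : height b (b' i) ≤ 0 := by
  refine h.left.height_nonpos _ (h.right.mem i) fun j hj => ?_
  rcases eq_or_ne j i with rfl | hji
  · exact h.ne hj
  · exact hji (b'.injective (hj.trans (h.eq_of_ne j hji).symm)).symm

lemma height_eq_add (h : IsAdjacent V b b' i) (v : M) :
    height b v = height b' v + (height b (b' i) - 1) * b'.repr v i := by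
  classical
  have key : height b = height b' + (height b (b' i) - 1) • b'.coord i := b'.ext fun j => by
    rcases eq_or_ne j i with rfl | hji
    · simp
    · have hbj : height b (b' j) = 1 := by rw [h.eq_of_ne j hji, height_basis]
      simp [hbj, hji]
  simpa using DFunLike.congr_fun key v

lemma repr_eq_mul (h : IsAdjacent V b b' i) (v : M) :
    b.repr v i = b.repr (b' i) i * b'.repr v i := by
  classical
  have key : b.coord i = b.repr (b' i) i • b'.coord i := b'.ext fun j => by
    rcases eq_or_ne j i with rfl | hji
    · simp
    · have hbj : b.repr (b' j) i = 0 := by simp [h.eq_of_ne j hji, hji]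
      simp [hbj, hji]
  simpa using DFunLike.congr_fun key v

lemma repr_new (h : IsAdjacent V b b' i) : b.repr (b' i) i = -1 := by
  have hmul : b.repr (b' i) i * b'.repr (b i) i = 1 := by simpa using (h.repr_eq_mul (b i)).symm
  rcases Int.eq_one_or_neg_one_of_mul_eq_one hmul with h1 | h1
  · have hheight := h.height_eq_add (b i)
    rw [h1, one_mul] at hmul
    rw [hmul, height_basis] at hheight
    linarith [h.height_new_nonpos, h.symm.height_new_nonpos]
  · exact h1

lemma repr_self (h : IsAdjacent V b b' i) (v : M) : b'.repr v i = -b.repr v i := by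
  rw [h.repr_eq_mul v, h.repr_new]
  ring

lemma repr_of_ne (h : IsAdjacent V b b' i) (hji : j ≠ i) (v : M) :
    b'.repr v j = b.repr v j + b.repr (b' i) j * b.repr v i := by
  classical
  have key : b.coord j = b'.coord j + b.repr (b' i) j • b'.coord i := b'.ext fun k => by
    rcases eq_or_ne k i with rfl | hki
    · simp [hji.symm]
    · have hbk : b.repr (b' k) j = b'.repr (b' k) j := by
        rw [h.eq_of_ne k hki, b.repr_self, ← h.eq_of_ne k hki, b'.repr_self]
      simp [hbk, hki]
  have hv := DFunLike.congr_fun key v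
  simp only [Basis.coord_apply, LinearMap.add_apply, LinearMap.smul_apply, smul_eq_mul] at hv
  rw [hv, h.repr_self]
  ring

lemma height_eq (h : IsAdjacent V b b' i) (v : M) :
    height b' v = height b v + (height b (b' i) - 1) * b.repr v i := by
  rw [h.height_eq_add v, h.repr_self]
  ring

lemma eq_new_of_height_pos (h : IsAdjacent V b b' i) (hv : v ∈ V) (hb : height b v ≤ 0)
    (hb' : 0 < height b' v) : v = b' i := by
  obtain ⟨j, rfl⟩ := h.right.exists_eq_of_height_pos hv hb'
  rcases eq_or_ne j i with rfl | hji
  · rfl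
  · rw [h.eq_of_ne j hji, height_basis] at hb
    exact absurd hb one_pos.not_ge

lemma height_nonpos_of_ne (h : IsAdjacent V b b' i) (hv : v ∈ V) (hb : height b v ≤ 0)
    (hne : v ≠ b' i) : height b' v ≤ 0 := by
  by_contra! hb'
  exact hne (h.eq_new_of_height_pos hv hb hb')

lemma eq_new_of_height_ge (h : IsAdjacent V b b' i) (hv : v ∈ V) (hb : height b v ≤ 0)
    (hle : height b (b' i) ≤ height b v) (hi : b.repr v i < 0) : v = b' i := by
  refine h.eq_new_of_height_pos hv hb ?_
  rw [h.height_eq]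
  nlinarith [h.height_new_nonpos]

end IsAdjacent

variable (ι) in
/-- The vertex sets of the simplicial polytopes all of whose facets are spanned by lattice bases:
there is a facet, and every facet has a neighbour across each of its ridges. -/
structure IsFanoConfig (V : Finset M) : Prop where
  exists_facetBasis : ∃ b : Basis ι ℤ M, IsFacetBasis V b
  exists_adjacent : ∀ b : Basis ι ℤ M, IsFacetBasis V b → ∀ i, ∃ b', IsAdjacent V b b' i

namespace IsFanoConfig

lemma neg_one_le_repr (hV : IsFanoConfig ι V) (hb : IsFacetBasis V b) (hv : v ∈ V)
    (h0 : height b v = 0) (i : ι) : -1 ≤ b.repr v i := by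
  obtain ⟨b', h⟩ := hV.exists_adjacent b hb i
  rcases lt_or_ge (b.repr v i) 0 with hi | hi
  · rw [h.eq_new_of_height_ge hv h0.le (h.height_new_nonpos.trans h0.ge) hi, h.repr_new]
  · exact (neg_one_lt_zero.trans_le hi).le

lemma eq_of_repr_neg (hV : IsFanoConfig ι V) (hb : IsFacetBasis V b) (hv : v ∈ V) (hw : w ∈ V)
    (hv0 : height b v = 0) (hw0 : height b w = 0) (hvi : b.repr v i < 0) (hwi : b.repr w i < 0) :
    v = w := by
  obtain ⟨b', h⟩ := hV.exists_adjacent b hb i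
  rw [h.eq_new_of_height_ge hv hv0.le (h.height_new_nonpos.trans hv0.ge) hvi,
    h.eq_new_of_height_ge hw hw0.le (h.height_new_nonpos.trans hw0.ge) hwi]

lemma exists_facetBasis_repr_nonneg (hV : IsFanoConfig ι V) (s : M) :
    ∃ b : Basis ι ℤ M, IsFacetBasis V b ∧ ∀ i, 0 ≤ b.repr s i := by
  have hfin : {b : Basis ι ℤ M | IsFacetBasis V b}.Finite :=
    Set.Finite.of_injOn (f := fun b : Basis ι ℤ M => ⇑b) (t := {f | ∀ i, f i ∈ V})
      (fun b hb => hb.mem)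
      (fun b _ b' _ h => Basis.eq_of_apply_eq (congrFun h))
      (Set.Finite.pi' fun _ => V.finite_toSet)
  obtain ⟨b, hb, hmax⟩ := Set.exists_max_image _ (fun b => height b s) hfin hV.exists_facetBasis
  refine ⟨b, hb, fun i => ?_⟩
  by_contra! hi
  obtain ⟨b', h⟩ := hV.exists_adjacent b hb i
  have hle := hmax b' h.right
  rw [h.height_eq] at hle
  nlinarith [h.height_new_nonpos]

end IsFanoConfig

variable (ι) in
/-- The vertex sets of the polytopes as in `IsFanoConfig` that are moreover 2-neighbourly: for any
two elements some functional attains its (positive) maximum over `V` at these two only. -/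
structure IsNeighbourlyConfig (V : Finset M) : Prop extends IsFanoConfig ι V where
  exists_edge : ∀ v ∈ V, ∀ w ∈ V, v ≠ w → ∃ (φ : M →+ ℝ) (c : ℝ), 0 < c ∧ φ v = c ∧ φ w = c ∧
    ∀ x ∈ V, φ x ≤ c ∧ (φ x = c → x = v ∨ x = w)

namespace IsNeighbourlyConfig

lemma add_ne_zero (hV : IsNeighbourlyConfig ι V) (hv : v ∈ V) (hw : w ∈ V) (hvw : v ≠ w) :
    v + w ≠ 0 := by
  obtain ⟨φ, c, hc, hφv, hφw, -⟩ := hV.exists_edge v hv w hw hvw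
  intro h
  have := congrArg φ h
  rw [map_add, map_zero] at this
  linarith

lemma add_ne_of_mem (hV : IsNeighbourlyConfig ι V) (hv : v ∈ V) (hw : w ∈ V) (hvw : v ≠ w)
    (hx : x ∈ V) : v + w ≠ x := by
  obtain ⟨φ, c, hc, hφv, hφw, hφ⟩ := hV.exists_edge v hv w hw hvw
  rintro rfl
  have := (hφ _ hx).1
  rw [map_add] at this
  linarith

lemma eq_or_eq_of_add_eq_add (hV : IsNeighbourlyConfig ι V) (hv : v ∈ V) (hw : w ∈ V) (hvw : v ≠ w)
    (hx : x ∈ V) (hy : y ∈ V) (h : v + w = x + y) : x = v ∨ x = w := by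
  obtain ⟨φ, c, -, hφv, hφw, hφ⟩ := hV.exists_edge v hv w hw hvw
  refine (hφ x hx).2 ((hφ x hx).1.antisymm ?_)
  have := congrArg φ h
  rw [map_add, map_add] at this
  linarith [(hφ y hy).1]

lemma exists_repr_neg_ne (hV : IsNeighbourlyConfig ι V) (hb : IsFacetBasis V b) (hv : v ∈ V)
    (h0 : height b v ≤ 0) (hi : -1 ≤ b.repr v i) : ∃ j ≠ i, b.repr v j < 0 := by
  classical
  by_contra! hj
  have hvi : v ≠ b i := by
    rintro rfl
    simp at h0
  have hnonneg (j : ι) : 0 ≤ b.repr (v + b i) j := by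
    rcases eq_or_ne i j with rfl | hij
    · simpa using neg_le_iff_add_nonneg.1 hi
    · simpa [hij] using hj j hij.symm
  rcases eq_zero_or_eq_basis_of_repr_nonneg hnonneg (by simpa using h0) with h | ⟨j, h⟩
  · exact hV.add_ne_zero hv (hb.mem i) hvi h
  · exact hV.add_ne_of_mem hv (hb.mem i) hvi (hb.mem j) h

lemma exists_two_neg [Nonempty ι] (hV : IsNeighbourlyConfig ι V) (hb : IsFacetBasis V b)
    (hv : v ∈ V) (h0 : height b v ≤ 0) (hge : ∀ i, -1 ≤ b.repr v i) :
    ∃ i j, i ≠ j ∧ b.repr v i < 0 ∧ b.repr v j < 0 := by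
  obtain ⟨i, -, hi⟩ := hV.exists_repr_neg_ne hb hv h0 (hge (Classical.arbitrary ι))
  obtain ⟨j, hji, hj⟩ := hV.exists_repr_neg_ne hb hv h0 (hge i)
  exact ⟨i, j, hji.symm, hi, hj⟩

end IsNeighbourlyConfig

lemma two_mul_card_le_of_repr_neg {S : Finset M}
    (htwo : ∀ v ∈ S, ∃ i j, i ≠ j ∧ b.repr v i < 0 ∧ b.repr v j < 0)
    (huniq : ∀ v ∈ S, ∀ w ∈ S, ∀ i, b.repr v i < 0 → b.repr w i < 0 → v = w) :
    2 * #S ≤ Fintype.card ι := by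
  classical
  let neg (v : M) : Finset ι := {i | b.repr v i < 0}
  have hmem {v : M} {i : ι} : i ∈ neg v ↔ b.repr v i < 0 := by simp [neg]
  have hdisj : (S : Set M).PairwiseDisjoint neg := fun v hv w hw hne =>
    disjoint_left.2 fun i hi hi' => hne (huniq v hv w hw i (hmem.1 hi) (hmem.1 hi'))
  calc 2 * #S = ∑ _v ∈ S, 2 := by rw [sum_const, smul_eq_mul, mul_comm]
    _ ≤ ∑ v ∈ S, #(neg v) := sum_le_sum fun v hv => by
        obtain ⟨i, j, hij, hi, hj⟩ := htwo v hv
        exact one_lt_card.2 ⟨i, hmem.2 hi, j, hmem.2 hj, hij⟩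
    _ = #(S.biUnion neg) := (card_biUnion hdisj).symm
    _ ≤ Fintype.card ι := card_le_univ _

section Layers

/-- The elements of `V` in the hyperplane through `0` parallel to the facet `b`. -/
noncomputable def zeroLayer (V : Finset M) (b : Basis ι ℤ M) : Finset M :=
  {v ∈ V | height b v = 0}

/-- The elements of `V` strictly below the hyperplane through `0` parallel to the facet `b`. -/
noncomputable def negLayer (V : Finset M) (b : Basis ι ℤ M) : Finset M :=
  {v ∈ V | height b v < 0}

lemma mem_zeroLayer : v ∈ zeroLayer V b ↔ v ∈ V ∧ height b v = 0 := mem_filter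

lemma mem_negLayer : v ∈ negLayer V b ↔ v ∈ V ∧ height b v < 0 := mem_filter

lemma height_le_neg_one_of_mem_negLayer (hv : v ∈ negLayer V b) : height b v ≤ -1 :=
  Int.le_sub_one_of_lt (mem_negLayer.1 hv).2

lemma sum_height_le_neg_card : ∑ v ∈ negLayer V b, height b v ≤ -(#(negLayer V b) : ℤ) := by
  simpa using sum_le_card_nsmul _ _ (-1) fun v hv => height_le_neg_one_of_mem_negLayer hv

lemma IsFacetBasis.sum_eq {A : Type*} [AddCommMonoid A] (hb : IsFacetBasis V b) (f : M → A) :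
    ∑ v ∈ V, f v = ∑ i, f (b i) + (∑ v ∈ zeroLayer V b, f v + ∑ v ∈ negLayer V b, f v) := by
  have htop : ({v ∈ V | 0 < height b v} : Finset M) = univ.map ⟨b, b.injective⟩ := by
    ext v
    simp only [mem_filter, mem_map, mem_univ, true_and, Function.Embedding.coeFn_mk]
    constructor
    · rintro ⟨hv, hpos⟩
      obtain ⟨i, rfl⟩ := hb.exists_eq_of_height_pos hv hpos
      exact ⟨i, rfl⟩
    · rintro ⟨i, rfl⟩
      simp [hb.mem i]
  have hzero : ({v ∈ {v ∈ V | ¬ 0 < height b v} | height b v = 0} : Finset M) = zeroLayer V b := by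
    ext v
    simp only [mem_filter, mem_zeroLayer]
    grind
  have hneg : ({v ∈ {v ∈ V | ¬ 0 < height b v} | ¬ height b v = 0} : Finset M) = negLayer V b := by
    ext v
    simp only [mem_filter, mem_negLayer]
    grind
  rw [← sum_filter_add_sum_filter_not V (0 < height b ·), htop, sum_map,
    ← sum_filter_add_sum_filter_not _ (height b · = 0), hzero, hneg]
  rfl

lemma IsFacetBasis.card_eq (hb : IsFacetBasis V b) :
    #V = Fintype.card ι + (#(zeroLayer V b) + #(negLayer V b)) := by
  rw [card_eq_sum_ones, hb.sum_eq]
  simp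

lemma IsNeighbourlyConfig.two_mul_card_zeroLayer_le [Nonempty ι] (hV : IsNeighbourlyConfig ι V)
    (hb : IsFacetBasis V b) : 2 * #(zeroLayer V b) ≤ Fintype.card ι := by
  refine two_mul_card_le_of_repr_neg (b := b) (fun v hv => ?_) fun v hv w hw i => ?_
  · obtain ⟨hv, hv0⟩ := mem_zeroLayer.1 hv
    exact hV.exists_two_neg hb hv hv0.le (hV.neg_one_le_repr hb hv hv0)
  · obtain ⟨hv, hv0⟩ := mem_zeroLayer.1 hv
    obtain ⟨hw, hw0⟩ := mem_zeroLayer.1 hw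
    exact hV.eq_of_repr_neg hb hv hw hv0 hw0

/-- A special facet (in the terminology of Øbro): its cone contains the sum of all vertices. -/
structure IsSpecialFacet (V : Finset M) (b : Basis ι ℤ M) : Prop extends IsFacetBasis V b where
  repr_sum_nonneg : ∀ i, 0 ≤ b.repr (∑ v ∈ V, v) i

namespace IsSpecialFacet

lemma repr_sum_eq (hb : IsSpecialFacet V b) (i : ι) : b.repr (∑ v ∈ V, v) i =
    1 + (∑ v ∈ zeroLayer V b, b.repr v i + ∑ v ∈ negLayer V b, b.repr v i) := by
  classical
  rw [map_sum, Finsupp.finsetSum_apply, hb.sum_eq]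
  simp [Finsupp.single_apply]

lemma height_sum_eq (hb : IsSpecialFacet V b) :
    height b (∑ v ∈ V, v) = Fintype.card ι + ∑ v ∈ negLayer V b, height b v := by
  have hzero : ∑ v ∈ zeroLayer V b, height b v = 0 :=
    sum_eq_zero fun v hv => (mem_zeroLayer.1 hv).2
  rw [map_sum, hb.sum_eq, hzero]
  simp

lemma neg_card_le_sum_height (hb : IsSpecialFacet V b) :
    -(Fintype.card ι : ℤ) ≤ ∑ v ∈ negLayer V b, height b v := by
  have : 0 ≤ height b (∑ v ∈ V, v) := by
    rw [height_apply]
    exact sum_nonneg fun i _ => hb.repr_sum_nonneg i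
  rw [hb.height_sum_eq] at this
  linarith

lemma sum_repr_eq_neg_one (hb : IsSpecialFacet V b)
    (h : ∑ v ∈ negLayer V b, height b v = -(Fintype.card ι : ℤ)) (i : ι) :
    ∑ v ∈ zeroLayer V b, b.repr v i + ∑ v ∈ negLayer V b, b.repr v i = -1 := by
  have hs : ∑ v ∈ V, v = 0 := by
    refine eq_zero_of_repr_nonneg hb.repr_sum_nonneg ?_
    rw [hb.height_sum_eq, h, add_neg_cancel]
  have := hb.repr_sum_eq i
  rw [hs, map_zero, Finsupp.zero_apply] at this
  linarith

lemma card_negLayer_le (hb : IsSpecialFacet V b) : #(negLayer V b) ≤ Fintype.card ι := by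
  have := hb.neg_card_le_sum_height.trans sum_height_le_neg_card
  omega

lemma height_eq_neg_one (hb : IsSpecialFacet V b) (hcard : #(negLayer V b) = Fintype.card ι)
    (hv : v ∈ negLayer V b) : height b v = -1 := by
  have hle : ∀ w ∈ negLayer V b, height b w ≤ -1 := fun w hw =>
    height_le_neg_one_of_mem_negLayer hw
  refine (sum_eq_sum_iff_of_le hle).1 ((sum_le_sum hle).antisymm ?_) v hv
  simpa [hcard] using hb.neg_card_le_sum_height

end IsSpecialFacet

lemma IsFanoConfig.exists_isSpecialFacet (hV : IsFanoConfig ι V) :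
    ∃ b : Basis ι ℤ M, IsSpecialFacet V b := by
  obtain ⟨b, hb, hs⟩ := hV.exists_facetBasis_repr_nonneg (∑ v ∈ V, v)
  exact ⟨b, ⟨hb, hs⟩⟩

namespace IsAdjacent

lemma height_new_neg (h : IsAdjacent V b b' i) (hZ : ∀ z ∈ zeroLayer V b, 0 ≤ b.repr z i) :
    height b (b' i) < 0 := by
  refine h.height_new_nonpos.lt_of_ne fun h0 => ?_
  have := hZ _ (mem_zeroLayer.2 ⟨h.right.mem i, h0⟩)
  rw [h.repr_new] at this
  exact absurd this (by decide)

lemma eq_new_of_height_neg_one (h : IsAdjacent V b b' i)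
    (hZ : ∀ z ∈ zeroLayer V b, 0 ≤ b.repr z i) (hv : v ∈ V) (h1 : height b v = -1)
    (hi : b.repr v i < 0) : v = b' i := by
  have := h.height_new_neg hZ
  exact h.eq_new_of_height_ge hv (by omega) (by omega) hi

lemma neg_one_le_sum_repr (h : IsAdjacent V b b' i) (hZ : ∀ z ∈ zeroLayer V b, 0 ≤ b.repr z i)
    (hN : ∀ v ∈ negLayer V b, height b v = -1) : -1 ≤ ∑ v ∈ negLayer V b, b.repr v i := by
  classical
  calc (-1 : ℤ) ≤ ∑ v ∈ negLayer V b, if v = b' i then -1 else 0 := by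
        rw [sum_ite_eq']
        split_ifs <;> simp
    _ ≤ ∑ v ∈ negLayer V b, b.repr v i := sum_le_sum fun v hv => by
        split_ifs with hvi
        · rw [hvi, h.repr_new]
        · by_contra! hneg
          exact hvi (h.eq_new_of_height_neg_one hZ (mem_negLayer.1 hv).1 (hN v hv) hneg)

end IsAdjacent

namespace IsNeighbourlyConfig

lemma card_negLayer_lt_of_zeroLayer_eq_empty [Nonempty ι] (hV : IsNeighbourlyConfig ι V)
    (hb : IsSpecialFacet V b) (hZ : zeroLayer V b = ∅) : #(negLayer V b) < Fintype.card ι := by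
  refine hb.card_negLayer_le.lt_of_ne fun hcard => ?_
  have hnew {b' : Basis ι ℤ M} {i : ι} (h : IsAdjacent V b b' i) {v : M} (hv : v ∈ negLayer V b) :
      b.repr v i < 0 → v = b' i :=
    h.eq_new_of_height_neg_one (by simp [hZ]) (mem_negLayer.1 hv).1 (hb.height_eq_neg_one hcard hv)
  have htwo : ∀ v ∈ negLayer V b, ∃ i j, i ≠ j ∧ b.repr v i < 0 ∧ b.repr v j < 0 := fun v hv => by
    refine hV.exists_two_neg hb.toIsFacetBasis (mem_negLayer.1 hv).1 (mem_negLayer.1 hv).2.le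
      fun i => ?_
    obtain ⟨b', h⟩ := hV.exists_adjacent b hb.toIsFacetBasis i
    rcases lt_or_ge (b.repr v i) 0 with hi | hi
    · rw [hnew h hv hi, h.repr_new]
    · exact (neg_one_lt_zero.trans_le hi).le
  have := two_mul_card_le_of_repr_neg htwo fun v hv w hw i hvi hwi => by
    obtain ⟨b', h⟩ := hV.exists_adjacent b hb.toIsFacetBasis i
    rw [hnew h hv hvi, hnew h hw hwi]
  have := Fintype.card_pos (α := ι)
  omega

lemma card_negLayer_add_two_le [Nonempty ι] (hV : IsNeighbourlyConfig ι V)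
    (hb : IsSpecialFacet V b) (hZ : zeroLayer V b = {x})
    (hN : ∀ v ∈ negLayer V b, height b v = -1) : #(negLayer V b) + 2 ≤ Fintype.card ι := by
  classical
  obtain ⟨hx, hx0⟩ := mem_zeroLayer.1 (hZ ▸ mem_singleton_self x)
  obtain ⟨i, j, hij, hi, hj⟩ :=
    hV.exists_two_neg hb.toIsFacetBasis hx hx0.le (hV.neg_one_le_repr hb.toIsFacetBasis hx hx0)
  have hmax (k : ι) : max (b.repr x k) 0 ≤ b.repr (∑ v ∈ V, v) k := by
    refine max_le ?_ (hb.repr_sum_nonneg k)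
    rcases lt_or_ge (b.repr x k) 0 with hk | hk
    · exact hk.le.trans (hb.repr_sum_nonneg k)
    · obtain ⟨b', h⟩ := hV.exists_adjacent b hb.toIsFacetBasis k
      have := h.neg_one_le_sum_repr (by simpa [hZ] using hk) hN
      rw [hb.repr_sum_eq, hZ, sum_singleton]
      linarith
  have hlt : ∀ k ∈ ({i, j} : Finset ι), b.repr x k + 1 ≤ max (b.repr x k) 0 := by
    simp only [mem_insert, mem_singleton, forall_eq_or_imp, forall_eq]
    omega
  have hsum : height b x + 2 ≤ height b (∑ v ∈ V, v) := calc
    height b x + 2 = ∑ k, (b.repr x k + if k ∈ ({i, j} : Finset ι) then 1 else 0) := by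
      rw [sum_add_distrib, ← height_apply, sum_ite_mem, univ_inter, sum_const, card_pair hij]
      rfl
    _ ≤ ∑ k, b.repr (∑ v ∈ V, v) k := sum_le_sum fun k _ => by
      refine le_trans ?_ (hmax k)
      split_ifs with hk
      · exact hlt k hk
      · simp
    _ = height b (∑ v ∈ V, v) := (height_apply _ _).symm
  have hneg : ∑ v ∈ negLayer V b, height b v = -(#(negLayer V b) : ℤ) := by
    rw [sum_congr rfl hN]
    simp
  rw [hx0, hb.height_sum_eq, hneg] at hsum
  omega

end IsNeighbourlyConfig

end Layers

section FourDimensional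

variable {b b' : Basis (Fin 4) ℤ M} {i j k l : Fin 4} {q : M}

lemma toFinset_eq_univ_of_nodup (h : [i, j, k, l].Nodup) :
    [i, j, k, l].toFinset = (univ : Finset (Fin 4)) :=
  eq_univ_of_card _ (List.toFinset_card_of_nodup h)

lemma height_eq_of_nodup (h : [i, j, k, l].Nodup) (v : M) :
    height b v = b.repr v i + b.repr v j + b.repr v k + b.repr v l := by
  rw [height_apply, ← toFinset_eq_univ_of_nodup h, List.sum_toFinset _ h]
  simp [add_assoc]

lemma forall_of_nodup (h : [i, j, k, l].Nodup) {p : Fin 4 → Prop} (hi : p i) (hj : p j)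
    (hk : p k) (hl : p l) (m : Fin 4) : p m := by
  have hm : m ∈ [i, j, k, l].toFinset := toFinset_eq_univ_of_nodup h ▸ mem_univ m
  simp only [List.mem_toFinset, List.mem_cons, List.not_mem_nil, or_false] at hm
  rcases hm with rfl | rfl | rfl | rfl <;> assumption

lemma eq_of_repr_eq_of_nodup (h : [i, j, k, l].Nodup) (hi : b.repr v i = b.repr w i)
    (hj : b.repr v j = b.repr w j) (hk : b.repr v k = b.repr w k) (hl : b.repr v l = b.repr w l) :
    v = w :=
  b.ext_elem (forall_of_nodup h hi hj hk hl)

lemma exists_nodup_of_ne : ∀ {i j : Fin 4}, i ≠ j → ∃ k l, [i, j, k, l].Nodup := by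
  decide

lemma IsNeighbourlyConfig.repr_neg_of_nodup (hV : IsNeighbourlyConfig (Fin 4) V)
    (hb : IsFacetBasis V b) (hv : v ∈ V) (h0 : height b v ≤ 0) (h : [i, j, k, l].Nodup)
    (hi : -1 ≤ b.repr v i) : b.repr v j < 0 ∨ b.repr v k < 0 ∨ b.repr v l < 0 := by
  obtain ⟨m, hmi, hm⟩ := hV.exists_repr_neg_ne hb hv h0 hi
  refine forall_of_nodup h (p := fun m => m ≠ i → b.repr v m < 0 → _) ?_ ?_ ?_ ?_ m hmi hm <;> tauto

section OneZero

/-- The case of three elements below a single element of height zero: `x` is the only element of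
height `0`, and the elements of negative height are `u`, `v` and `q`, of heights `-1`, `-1`, `-2`.
Then the sum of `V` vanishes, which is what `sum_repr` says. -/
structure IsOneZero (V : Finset M) (b : Basis (Fin 4) ℤ M) (x u v q : M) : Prop
    extends IsFacetBasis V b where
  zeroLayer_eq : zeroLayer V b = {x}
  mem_negLayer_iff : ∀ w, w ∈ negLayer V b ↔ w = u ∨ w = v ∨ w = q
  height_u : height b u = -1
  height_v : height b v = -1
  height_q : height b q = -2
  ne : u ≠ v
  sum_repr : ∀ k, b.repr x k + b.repr u k + b.repr v k + b.repr q k = -1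

namespace IsOneZero

lemma swap (h : IsOneZero V b x u v q) : IsOneZero V b x v u q where
  __ := h
  mem_negLayer_iff w := by rw [h.mem_negLayer_iff, or_left_comm]
  height_u := h.height_v
  height_v := h.height_u
  ne := h.ne.symm
  sum_repr k := by linarith [h.sum_repr k]

lemma mem_x (h : IsOneZero V b x u v q) : x ∈ V :=
  (mem_zeroLayer.1 (h.zeroLayer_eq ▸ mem_singleton_self x)).1

lemma height_x (h : IsOneZero V b x u v q) : height b x = 0 :=
  (mem_zeroLayer.1 (h.zeroLayer_eq ▸ mem_singleton_self x)).2

lemma mem_u (h : IsOneZero V b x u v q) : u ∈ V :=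
  (mem_negLayer.1 ((h.mem_negLayer_iff u).2 (.inl rfl))).1

lemma mem_q (h : IsOneZero V b x u v q) : q ∈ V :=
  (mem_negLayer.1 ((h.mem_negLayer_iff q).2 (.inr (.inr rfl)))).1

lemma u_ne_q (h : IsOneZero V b x u v q) : u ≠ q := by
  rintro rfl
  linarith [h.height_u, h.height_q]

lemma repr_eq_of_new_eq (h : IsOneZero V b x u v q) (hk : 0 ≤ b.repr x k)
    (hadj : IsAdjacent V b b' k) (hnew : b' k = u) : b.repr x k = 0 ∨
      b.repr x k = 1 ∧ b.repr q k = -1 ∧ b.repr u k = -1 ∧ b.repr v k = 0 := by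
  have hu : b.repr u k = -1 := hnew ▸ hadj.repr_new
  have hv : 0 ≤ b.repr v k := by
    by_contra! hneg
    refine h.ne.symm ((hadj.eq_new_of_height_ge h.swap.mem_u ?_ ?_ hneg).trans hnew)
    · linarith [h.height_v]
    · rw [hnew, h.height_u, h.height_v]
  have hq : -1 ≤ b.repr q k := by
    have hq0 := hadj.height_nonpos_of_ne h.mem_q (by linarith [h.height_q]) (hnew ▸ h.u_ne_q.symm)
    rw [hadj.height_eq, hnew, h.height_u, h.height_q] at hq0
    linarith
  have := h.sum_repr k
  omega

lemma repr_eq_of_nonneg (hV : IsFanoConfig (Fin 4) V) (h : IsOneZero V b x u v q)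
    (hk : 0 ≤ b.repr x k) : b.repr x k = 0 ∨ b.repr x k = 1 ∧ b.repr q k = -1 ∧
      (b.repr u k = -1 ∧ b.repr v k = 0 ∨ b.repr u k = 0 ∧ b.repr v k = -1) := by
  obtain ⟨b', hadj⟩ := hV.exists_adjacent b h.toIsFacetBasis k
  have hneg : b' k ∈ negLayer V b :=
    mem_negLayer.2 ⟨hadj.right.mem k, hadj.height_new_neg (by simpa [h.zeroLayer_eq] using hk)⟩
  rcases (h.mem_negLayer_iff _).1 hneg with hnew | hnew | hnew
  · have := h.repr_eq_of_new_eq hk hadj hnew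
    tauto
  · have := h.swap.repr_eq_of_new_eq hk hadj hnew
    tauto
  · have hu {u v : M} (h : IsOneZero V b x u v q) : 0 ≤ b.repr u k := by
      by_contra! hu
      refine h.u_ne_q ((hadj.eq_new_of_height_ge h.mem_u ?_ ?_ hu).trans hnew)
      · linarith [h.height_u]
      · linarith [hnew ▸ h.height_q, h.height_u]
    have hq : b.repr q k = -1 := hnew ▸ hadj.repr_new
    have := h.sum_repr k
    have := hu h
    have := hu h.swap
    omega

lemma neg_one_le_repr_of_repr_x_neg (hV : IsFanoConfig (Fin 4) V) (h : IsOneZero V b x u v q)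
    (hi : b.repr x i < 0) (hk : b.repr x k = 1) : -1 ≤ b.repr u i ∧ -1 ≤ b.repr q i := by
  obtain ⟨b', hadj⟩ := hV.exists_adjacent b h.toIsFacetBasis i
  have hnew : x = b' i :=
    hadj.eq_new_of_height_ge h.mem_x h.height_x.le (hadj.height_new_nonpos.trans h.height_x.ge) hi
  have heq (w : M) : height b' w = height b w - b.repr w i := by
    rw [hadj.height_eq, ← hnew, h.height_x]
    ring
  have hne {w : M} (hw : height b w < 0) : w ≠ b' i := by
    rintro rfl
    exact hw.ne (hnew ▸ h.height_x)
  have hu := hadj.height_nonpos_of_ne h.mem_u (by linarith [h.height_u])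
    (hne (by linarith [h.height_u]))
  have hq := hadj.height_nonpos_of_ne h.mem_q (by linarith [h.height_q])
    (hne (by linarith [h.height_q]))
  rw [heq, h.height_u] at hu
  rw [heq, h.height_q] at hq
  refine ⟨by linarith, ?_⟩
  by_contra! hqi
  have hq0 : height b' q = 0 := by
    rw [heq, h.height_q]
    linarith
  have hki : k ≠ i := by
    rintro rfl
    linarith
  have hqk : b.repr q k = -1 := by
    have := h.repr_eq_of_nonneg hV (k := k) (by linarith)
    omega
  have := hV.neg_one_le_repr hadj.right h.mem_q hq0 k
  rw [hadj.repr_of_ne hki, ← hnew, hk, hqk] at this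
  linarith

lemma false_of_same (hV : IsNeighbourlyConfig (Fin 4) V) (h : IsOneZero V b x u v q)
    (hijkl : [i, j, k, l].Nodup) (hi : b.repr x i < 0) (hj : b.repr x j < 0)
    (hk : b.repr x k = 1) (huk : b.repr u k = 0) (hul : b.repr u l = 0) : False := by
  have hui := (h.neg_one_le_repr_of_repr_x_neg hV.toIsFanoConfig hi hk).1
  have huj := (h.neg_one_le_repr_of_repr_x_neg hV.toIsFanoConfig hj hk).1
  have hheight := h.height_u
  have hjikl : [j, i, k, l].Nodup := by grind
  have h1 := hV.repr_neg_of_nodup h.toIsFacetBasis h.mem_u (by omega) hijkl hui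
  have h2 := hV.repr_neg_of_nodup h.toIsFacetBasis h.mem_u (by omega) hjikl huj
  rw [height_eq_of_nodup hijkl] at hheight
  omega

lemma false_of_split (hV : IsNeighbourlyConfig (Fin 4) V) (h : IsOneZero V b x u v q)
    (hijkl : [i, j, k, l].Nodup) (hi : b.repr x i = -1) (hj : b.repr x j = -1)
    (hk : b.repr x k = 1) (huk : b.repr u k = -1) (hul : b.repr u l = 0) (hvk : b.repr v k = 0)
    (hvl : b.repr v l = -1) : False := by
  have hklij : [k, l, i, j].Nodup := by grind
  have hlkij : [l, k, i, j].Nodup := by grind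
  have hi' : b.repr x i < 0 := by omega
  have hj' : b.repr x j < 0 := by omega
  obtain ⟨hui, hqi⟩ := h.neg_one_le_repr_of_repr_x_neg hV.toIsFanoConfig hi' hk
  obtain ⟨huj, hqj⟩ := h.neg_one_le_repr_of_repr_x_neg hV.toIsFanoConfig hj' hk
  have hvi := (h.swap.neg_one_le_repr_of_repr_x_neg hV.toIsFanoConfig hi' hk).1
  have hvj := (h.swap.neg_one_le_repr_of_repr_x_neg hV.toIsFanoConfig hj' hk).1
  have hu := h.height_u
  have hv := h.height_v
  have hq := h.height_q
  have hneg_u := hV.repr_neg_of_nodup h.toIsFacetBasis h.mem_u (by omega) hklij huk.ge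
  have hneg_v := hV.repr_neg_of_nodup h.toIsFacetBasis h.swap.mem_u (by omega) hlkij hvl.ge
  rw [height_eq_of_nodup hijkl] at hu hv hq
  have hsum_i := h.sum_repr i
  have hsum_j := h.sum_repr j
  have hsum_k := h.sum_repr k
  refine hV.add_ne_of_mem h.mem_u h.swap.mem_u h.ne h.mem_q ?_
  apply eq_of_repr_eq_of_nodup (b := b) hijkl <;> rw [map_add, Finsupp.add_apply] <;> omega

end IsOneZero

lemma IsNeighbourlyConfig.not_isOneZero (hV : IsNeighbourlyConfig (Fin 4) V) :
    ¬ IsOneZero V b x u v q := by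
  intro h
  have hx1 (m : Fin 4) : b.repr x m ≤ 1 := by
    by_contra! hm
    have := h.repr_eq_of_nonneg hV.toIsFanoConfig (k := m) (by omega)
    omega
  have hge := hV.neg_one_le_repr h.toIsFacetBasis h.mem_x h.height_x
  obtain ⟨i, j, hij, hi, hj⟩ := hV.exists_two_neg h.toIsFacetBasis h.mem_x h.height_x.le hge
  obtain ⟨k, l, hijkl⟩ := exists_nodup_of_ne hij
  have hx0 := h.height_x
  rw [height_eq_of_nodup hijkl] at hx0
  have hxi := hge i
  have hxj := hge j
  have hxk := hx1 k
  have hxl := hx1 l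
  replace hi : b.repr x i = -1 := by omega
  replace hj : b.repr x j = -1 := by omega
  have hk : b.repr x k = 1 := by omega
  obtain hk0 | ⟨-, -, ⟨huk, hvk⟩ | ⟨huk, hvk⟩⟩ :=
    h.repr_eq_of_nonneg hV.toIsFanoConfig (k := k) (by omega)
  all_goals obtain hl0 | ⟨-, -, ⟨hul, hvl⟩ | ⟨hul, hvl⟩⟩ :=
    h.repr_eq_of_nonneg hV.toIsFanoConfig (k := l) (by omega)
  any_goals omega
  · exact h.swap.false_of_same hV hijkl (by omega) (by omega) hk hvk hvl
  · exact h.false_of_split hV hijkl hi hj hk huk hul hvk hvl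
  · exact h.swap.false_of_split hV hijkl hi hj hk hvk hvl huk hul
  · exact h.false_of_same hV hijkl (by omega) (by omega) hk huk hul

lemma IsNeighbourlyConfig.card_negLayer_le_of_zeroLayer_eq_singleton
    (hV : IsNeighbourlyConfig (Fin 4) V) (hb : IsSpecialFacet V b) (hZ : zeroLayer V b = {x}) :
    #(negLayer V b) ≤ 2 := by
  classical
  by_contra! hcard
  by_cases hN : ∀ v ∈ negLayer V b, height b v = -1
  · have := hV.card_negLayer_add_two_le hb hZ hN
    simp only [Fintype.card_fin] at this
    omega
  push Not at hN
  obtain ⟨q, hq, hq1⟩ := hN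
  have hq2 : height b q ≤ -2 := by
    have := height_le_neg_one_of_mem_negLayer hq
    omega
  have hsum := add_sum_erase _ (height b) hq
  have hge := hb.neg_card_le_sum_height
  have hrest : ∑ v ∈ (negLayer V b).erase q, height b v ≤ -(#((negLayer V b).erase q) : ℤ) := by
    simpa using sum_le_card_nsmul _ _ (-1) fun v hv =>
      height_le_neg_one_of_mem_negLayer (mem_of_mem_erase hv)
  have herase := card_erase_of_mem hq
  rw [Fintype.card_fin] at hge
  obtain ⟨u, v, huv, huv_eq⟩ := card_eq_two.1 (show #((negLayer V b).erase q) = 2 by omega)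
  have hN : ∀ w, w ∈ negLayer V b ↔ w = u ∨ w = v ∨ w = q := fun w => by
    rw [← insert_erase hq, huv_eq]
    simp only [mem_insert, mem_singleton]
    tauto
  rw [huv_eq, sum_pair huv] at hsum
  have hu := height_le_neg_one_of_mem_negLayer ((hN u).2 (.inl rfl))
  have hv := height_le_neg_one_of_mem_negLayer ((hN v).2 (.inr (.inl rfl)))
  refine hV.not_isOneZero (x := x) (u := u) (v := v) (q := q) ⟨hb.toIsFacetBasis, hZ, hN, by omega,
    by omega, by omega, huv, fun k => ?_⟩
  have hk := hb.sum_repr_eq_neg_one (by rw [Fintype.card_fin]; omega) k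
  rw [hZ, sum_singleton, ← add_sum_erase _ _ hq, huv_eq, sum_pair huv] at hk
  linarith

end OneZero

section SplitPair

lemma IsNeighbourlyConfig.eq_of_add_basis_eq (hV : IsNeighbourlyConfig (Fin 4) V)
    (hb : IsFacetBasis V b) (hv : v ∈ V) (hw : w ∈ V) (hv0 : height b v ≤ 0) (hw0 : height b w ≤ 0)
    (h : v + b i = w + b j) : v = w := by
  have hne {v : M} (hv0 : height b v ≤ 0) (i : Fin 4) : v ≠ b i := by
    rintro rfl
    simp at hv0
  exact ((hV.eq_or_eq_of_add_eq_add hv (hb.mem i) (hne hv0 i) hw (hb.mem j) h).resolve_right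
    (hne hw0 i)).symm

lemma IsNeighbourlyConfig.eq_of_repr_eq_of_add_eq (hV : IsNeighbourlyConfig (Fin 4) V)
    (hb : IsFacetBasis V b) (hv : v ∈ V) (hw : w ∈ V) (hv0 : height b v ≤ 0) (hw0 : height b w ≤ 0)
    (h : [i, j, k, l].Nodup) (hk : b.repr v k = b.repr w k) (hl : b.repr v l = b.repr w l)
    (hvi : -1 ≤ b.repr v i) (hvj : -1 ≤ b.repr v j) (hwi : -1 ≤ b.repr w i)
    (hwj : -1 ≤ b.repr w j) (hvij : b.repr v i + b.repr v j = -1)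
    (hwij : b.repr w i + b.repr w j = -1) : v = w := by
  obtain ⟨hij, hik, hil, hjk, hjl⟩ : i ≠ j ∧ i ≠ k ∧ i ≠ l ∧ j ≠ k ∧ j ≠ l := by grind
  obtain hi | ⟨hvi, hwi⟩ | ⟨hvi, hwi⟩ : b.repr v i = b.repr w i ∨
      b.repr v i = -1 ∧ b.repr w i = 0 ∨ b.repr v i = 0 ∧ b.repr w i = -1 := by omega
  · exact eq_of_repr_eq_of_nodup h hi (by omega) hk hl
  · refine hV.eq_of_add_basis_eq (i := i) (j := j) hb hv hw hv0 hw0 ?_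
    apply eq_of_repr_eq_of_nodup (b := b) h <;> simp [*]
    omega
  · refine hV.eq_of_add_basis_eq (i := j) (j := i) hb hv hw hv0 hw0 ?_
    apply eq_of_repr_eq_of_nodup (b := b) h <;> simp [*]
    omega

/-- Two elements `x`, `y` of height zero with respect to the facet `b`: `x` is negative precisely
at the indices `i`, `j`, and `y` at the complementary indices `k`, `l`. -/
structure IsSplitPair (V : Finset M) (b : Basis (Fin 4) ℤ M) (i j k l : Fin 4) (x y : M) : Prop
    extends IsFacetBasis V b where
  nodup : [i, j, k, l].Nodup
  mem_x : x ∈ V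
  mem_y : y ∈ V
  x_i : b.repr x i = -1
  x_j : b.repr x j = -1
  x_k : 0 ≤ b.repr x k
  x_l : 0 ≤ b.repr x l
  x_kl : b.repr x k + b.repr x l = 2
  y_i : 0 ≤ b.repr y i
  y_j : 0 ≤ b.repr y j
  y_ij : b.repr y i + b.repr y j = 2
  y_k : b.repr y k = -1
  y_l : b.repr y l = -1

namespace IsSplitPair

lemma swap (h : IsSplitPair V b i j k l x y) : IsSplitPair V b j i k l x y where
  __ := h
  nodup := by grind [h.nodup]
  x_i := h.x_j
  x_j := h.x_i
  y_i := h.y_j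
  y_j := h.y_i
  y_ij := by linarith [h.y_ij]

lemma symm (h : IsSplitPair V b i j k l x y) : IsSplitPair V b k l i j y x where
  __ := h
  nodup := by grind [h.nodup]
  mem_x := h.mem_y
  mem_y := h.mem_x
  x_i := h.y_k
  x_j := h.y_l
  x_k := h.y_i
  x_l := h.y_j
  x_kl := h.y_ij
  y_i := h.x_k
  y_j := h.x_l
  y_ij := h.x_kl
  y_k := h.x_i
  y_l := h.x_j

lemma of_repr_neg (hV : IsNeighbourlyConfig (Fin 4) V) (hb : IsFacetBasis V b)
    (hx : x ∈ V) (hy : y ∈ V) (hx0 : height b x = 0) (hy0 : height b y = 0) (hxy : x ≠ y)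
    (h : [i, j, k, l].Nodup) (hi : b.repr x i < 0) (hj : b.repr x j < 0) :
    IsSplitPair V b i j k l x y := by
  have hxge := hV.neg_one_le_repr hb hx hx0
  have hyge := hV.neg_one_le_repr hb hy hy0
  have hdisj (m : Fin 4) : 0 ≤ b.repr x m ∨ 0 ≤ b.repr y m := by
    by_contra! hm
    exact hxy (hV.eq_of_repr_neg hb hx hy hx0 hy0 hm.1 hm.2)
  have hxi := hxge i
  have hxj := hxge j
  have hyk := hyge k
  have hyl := hyge l
  have hdi := hdisj i
  have hdj := hdisj j
  have hdk := hdisj k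
  have hdl := hdisj l
  have hyk_neg := hV.repr_neg_of_nodup (i := k) (j := l) (k := i) (l := j) hb hy hy0.le
    (by grind) hyk
  have hyl_neg := hV.repr_neg_of_nodup (i := l) (j := k) (k := i) (l := j) hb hy hy0.le
    (by grind) hyl
  rw [height_eq_of_nodup h] at hx0 hy0
  constructor <;> first | assumption | omega

lemma x_height (h : IsSplitPair V b i j k l x y) : height b x = 0 := by
  rw [height_eq_of_nodup h.nodup, h.x_i, h.x_j]
  linarith [h.x_kl]

lemma eq_new (h : IsSplitPair V b i j k l x y) (hadj : IsAdjacent V b b' i) : b' i = x :=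
  (hadj.eq_new_of_height_ge h.mem_x h.x_height.le (hadj.height_new_nonpos.trans h.x_height.ge)
    (by rw [h.x_i]; decide)).symm

lemma height_adjacent (h : IsSplitPair V b i j k l x y) (hadj : IsAdjacent V b b' i) (v : M) :
    height b' v = height b v - b.repr v i := by
  rw [hadj.height_eq, h.eq_new hadj, h.x_height]
  ring

lemma repr_adjacent (h : IsSplitPair V b i j k l x y) (hadj : IsAdjacent V b b' i) {m : Fin 4}
    (hm : m ≠ i) (v : M) : b'.repr v m = b.repr v m + b.repr x m * b.repr v i := by
  rw [hadj.repr_of_ne hm, h.eq_new hadj]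

lemma height_le_repr (hV : IsFanoConfig (Fin 4) V) (h : IsSplitPair V b i j k l x y) (hw : w ∈ V)
    (hneg : height b w < 0) : height b w ≤ b.repr w i := by
  obtain ⟨b', hadj⟩ := hV.exists_adjacent b h.toIsFacetBasis i
  have hne : w ≠ b' i := by
    rw [h.eq_new hadj]
    rintro rfl
    exact hneg.ne h.x_height
  have := hadj.height_nonpos_of_ne hw hneg.le hne
  rw [h.height_adjacent hadj] at this
  linarith

lemma flip (hV : IsNeighbourlyConfig (Fin 4) V) (h : IsSplitPair V b i j k l x y)
    (hadj : IsAdjacent V b b' i) (hw : w ∈ V) (hw0 : height b w ≤ 0)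
    (hwi : height b w = b.repr w i) : IsSplitPair V b' i j k l (b i) w := by
  have hji : j ≠ i := by grind [h.nodup]
  refine of_repr_neg hV hadj.right (h.mem i) hw ?_ ?_ ?_ h.nodup ?_ ?_
  · simp [h.height_adjacent hadj]
  · rw [h.height_adjacent hadj, hwi, sub_self]
  · rintro rfl
    simp at hw0
  · simp [hadj.repr_self]
  · simp [h.repr_adjacent hadj hji, h.x_j, hji.symm]

lemma repr_add_repr (hV : IsNeighbourlyConfig (Fin 4) V) (h : IsSplitPair V b i j k l x y)
    (hw : w ∈ V) (hw0 : height b w ≤ 0) (hwi : height b w = b.repr w i) :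
    b.repr w k + b.repr w l = -2 - 2 * height b w := by
  obtain ⟨b', hadj⟩ := hV.exists_adjacent b h.toIsFacetBasis i
  have hflip := h.flip hV hadj hw hw0 hwi
  have hk := hflip.y_k
  have hl := hflip.y_l
  rw [h.repr_adjacent hadj (by grind [h.nodup])] at hk hl
  rw [hwi]
  linear_combination hk + hl - b.repr w i * h.x_kl

lemma repr_nonneg_of_height_eq_neg_one (hV : IsNeighbourlyConfig (Fin 4) V)
    (h : IsSplitPair V b i j k l x y) (hw : w ∈ V) (h1 : height b w = -1) : 0 ≤ b.repr w i := by
  have hneg : height b w < 0 := by omega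
  have hi := h.height_le_repr hV.toIsFanoConfig hw hneg
  have hk := h.symm.height_le_repr hV.toIsFanoConfig hw hneg
  have hl := h.symm.swap.height_le_repr hV.toIsFanoConfig hw hneg
  have hi_sum := h.repr_add_repr hV hw hneg.le
  have hk_sum := h.symm.repr_add_repr hV hw hneg.le
  have hl_sum := h.symm.swap.repr_add_repr hV hw hneg.le
  have hexists := hV.repr_neg_of_nodup h.toIsFacetBasis hw hneg.le h.nodup (h1 ▸ hi)
  have hsum := height_eq_of_nodup (b := b) h.nodup w
  omega

lemma height_ne_neg_one (hV : IsNeighbourlyConfig (Fin 4) V) (h : IsSplitPair V b i j k l x y)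
    (hw : w ∈ V) : height b w ≠ -1 := by
  intro h1
  have hi := h.repr_nonneg_of_height_eq_neg_one hV hw h1
  have hj := h.swap.repr_nonneg_of_height_eq_neg_one hV hw h1
  have hk := h.symm.repr_nonneg_of_height_eq_neg_one hV hw h1
  have hl := h.symm.swap.repr_nonneg_of_height_eq_neg_one hV hw h1
  rw [height_eq_of_nodup h.nodup] at h1
  omega

lemma repr_nonneg_of_height_eq_neg_two (hV : IsNeighbourlyConfig (Fin 4) V)
    (h : IsSplitPair V b i j k l x y) (hw : w ∈ V) (h2 : height b w = -2)
    (hyi : b.repr y i = 0) : 0 ≤ b.repr w i := by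
  obtain ⟨b', hadj⟩ := hV.exists_adjacent b h.toIsFacetBasis i
  have hy := h.flip hV hadj h.mem_y h.symm.x_height.le (h.symm.x_height.trans hyi.symm)
  have hi := h.height_le_repr hV.toIsFanoConfig hw (by omega)
  have hne_neg_one := hy.height_ne_neg_one hV hw
  rw [h.height_adjacent hadj] at hne_neg_one
  by_contra! hneg
  have hwi : height b w = b.repr w i := by omega
  have hwflip := h.flip hV hadj hw (by omega) hwi
  have hwy : w = y := hV.eq_of_repr_neg (i := k) hadj.right hw h.mem_y hwflip.symm.x_height
    hy.symm.x_height (by rw [hwflip.y_k]; decide) (by rw [hy.y_k]; decide)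
  rw [hwy, h.symm.x_height] at h2
  exact absurd h2 (by decide)

lemma neg_one_le_repr_of_height_eq_neg_two (hV : IsNeighbourlyConfig (Fin 4) V)
    (h : IsSplitPair V b i j k l x y) (hw : w ∈ V) (h2 : height b w = -2) : -1 ≤ b.repr w i := by
  obtain ⟨b', hadj⟩ := hV.exists_adjacent b h.toIsFacetBasis i
  have hi := h.height_le_repr hV.toIsFanoConfig hw (by omega)
  by_contra! hneg
  have hwi : height b w = b.repr w i := by omega
  have hyi := (h.flip hV hadj hw (by omega) hwi).height_ne_neg_one hV h.mem_y
  rw [h.height_adjacent hadj, h.symm.x_height] at hyi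
  have hkl := h.repr_add_repr hV hw (by omega) hwi
  have hi0 := h.repr_nonneg_of_height_eq_neg_two hV hw h2
  have hj0 := h.swap.repr_nonneg_of_height_eq_neg_two hV hw h2
  have hyi_nonneg := h.y_i
  have hyj_nonneg := h.y_j
  have hy := h.y_ij
  rw [height_eq_of_nodup h.nodup] at h2 hwi
  omega

lemma repr_eq_or_y_eq_one (hV : IsNeighbourlyConfig (Fin 4) V) (h : IsSplitPair V b i j k l x y)
    (hv : v ∈ V) (hw : w ∈ V) (hv2 : height b v = -2) (hw2 : height b w = -2)
    (hsum : ∀ m, b.repr x m + b.repr y m + b.repr v m + b.repr w m = -1) :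
    b.repr v i = b.repr w i ∧ b.repr v j = b.repr w j ∧ b.repr v i + b.repr v j = -1 ∨
      b.repr y i = 1 ∧ b.repr y j = 1 := by
  have hvi := h.neg_one_le_repr_of_height_eq_neg_two hV hv hv2
  have hvj := h.swap.neg_one_le_repr_of_height_eq_neg_two hV hv hv2
  have hwi := h.neg_one_le_repr_of_height_eq_neg_two hV hw hw2
  have hwj := h.swap.neg_one_le_repr_of_height_eq_neg_two hV hw hw2
  have hvi0 := h.repr_nonneg_of_height_eq_neg_two hV hv hv2
  have hvj0 := h.swap.repr_nonneg_of_height_eq_neg_two hV hv hv2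
  have hwi0 := h.repr_nonneg_of_height_eq_neg_two hV hw hw2
  have hwj0 := h.swap.repr_nonneg_of_height_eq_neg_two hV hw hw2
  have hi := hsum i
  have hj := hsum j
  rw [h.x_i] at hi
  rw [h.x_j] at hj
  have := h.y_i
  have := h.y_j
  have := h.y_ij
  omega

lemma eq_of_repr_eq (hV : IsNeighbourlyConfig (Fin 4) V) (h : IsSplitPair V b i j k l x y)
    (hv : v ∈ V) (hw : w ∈ V) (hv2 : height b v = -2) (hw2 : height b w = -2)
    (hk : b.repr v k = b.repr w k) (hl : b.repr v l = b.repr w l)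
    (hkl : b.repr v k + b.repr v l = -1) : v = w := by
  have hv_sum := height_eq_of_nodup (b := b) h.nodup v
  have hw_sum := height_eq_of_nodup (b := b) h.nodup w
  exact hV.eq_of_repr_eq_of_add_eq h.toIsFacetBasis hv hw (by omega) (by omega) h.nodup hk hl
    (h.neg_one_le_repr_of_height_eq_neg_two hV hv hv2)
    (h.swap.neg_one_le_repr_of_height_eq_neg_two hV hv hv2)
    (h.neg_one_le_repr_of_height_eq_neg_two hV hw hw2)
    (h.swap.neg_one_le_repr_of_height_eq_neg_two hV hw hw2) (by omega) (by omega)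

lemma eq_of_height_eq_neg_two (hV : IsNeighbourlyConfig (Fin 4) V)
    (h : IsSplitPair V b i j k l x y) (hv : v ∈ V) (hw : w ∈ V) (hv2 : height b v = -2)
    (hw2 : height b w = -2)
    (hsum : ∀ m, b.repr x m + b.repr y m + b.repr v m + b.repr w m = -1) : v = w := by
  rcases h.repr_eq_or_y_eq_one hV hv hw hv2 hw2 hsum with ⟨hi, hj, hij⟩ | ⟨hyi, hyj⟩
  · exact h.symm.eq_of_repr_eq hV hv hw hv2 hw2 hi hj hij
  rcases h.symm.repr_eq_or_y_eq_one hV hv hw hv2 hw2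
    (fun m => by rw [add_comm (b.repr y m), hsum]) with ⟨hk, hl, hkl⟩ | ⟨hxk, hxl⟩
  · exact h.eq_of_repr_eq hV hv hw hv2 hw2 hk hl hkl
  have hxy : x ≠ y := by
    rintro rfl
    linarith [h.x_i]
  refine absurd ?_ (hV.add_ne_zero h.mem_x h.mem_y hxy)
  apply eq_of_repr_eq_of_nodup (b := b) h.nodup <;>
    simp [h.x_i, h.x_j, h.y_k, h.y_l, hyi, hyj, hxk, hxl]

end IsSplitPair

lemma IsNeighbourlyConfig.card_negLayer_le_of_zeroLayer_eq_pair [DecidableEq M]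
    (hV : IsNeighbourlyConfig (Fin 4) V) (hb : IsSpecialFacet V b) (hxy : x ≠ y)
    (hZ : zeroLayer V b = {x, y}) : #(negLayer V b) ≤ 1 := by
  obtain ⟨hx, hx0⟩ := mem_zeroLayer.1 (show x ∈ zeroLayer V b by simp [hZ])
  obtain ⟨hy, hy0⟩ := mem_zeroLayer.1 (show y ∈ zeroLayer V b by simp [hZ])
  obtain ⟨i, j, hij, hi, hj⟩ :=
    hV.exists_two_neg hb.toIsFacetBasis hx hx0.le (hV.neg_one_le_repr hb.toIsFacetBasis hx hx0)
  obtain ⟨k, l, hijkl⟩ := exists_nodup_of_ne hij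
  have h := IsSplitPair.of_repr_neg hV hb.toIsFacetBasis hx hy hx0 hy0 hxy hijkl hi hj
  have hle : ∀ w ∈ negLayer V b, height b w ≤ -2 := fun w hw => by
    have := height_le_neg_one_of_mem_negLayer hw
    have := h.height_ne_neg_one hV (mem_negLayer.1 hw).1
    omega
  have hge := hb.neg_card_le_sum_height
  have hsum : ∑ w ∈ negLayer V b, height b w ≤ _ := sum_le_card_nsmul _ _ _ hle
  rw [Fintype.card_fin] at hge
  rw [nsmul_eq_mul] at hsum
  by_contra! hcard
  obtain ⟨v, w, hvw, hN⟩ := card_eq_two.1 (show #(negLayer V b) = 2 by omega)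
  have hv : v ∈ negLayer V b := by simp [hN]
  have hw : w ∈ negLayer V b := by simp [hN]
  have hv2 := hle v hv
  have hw2 := hle w hw
  rw [hN, sum_pair hvw] at hge
  refine hvw (h.eq_of_height_eq_neg_two hV (mem_negLayer.1 hv).1 (mem_negLayer.1 hw).1 (by omega)
    (by omega) fun m => ?_)
  have hm := hb.sum_repr_eq_neg_one (by rw [Fintype.card_fin, hN, sum_pair hvw]; omega) m
  rw [hZ, hN, sum_pair hxy, sum_pair hvw] at hm
  linarith

lemma IsNeighbourlyConfig.card_le_seven (hV : IsNeighbourlyConfig (Fin 4) V) : #V ≤ 7 := by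
  classical
  obtain ⟨b, hb⟩ := hV.exists_isSpecialFacet
  have hcard := hb.card_eq
  have hzero := hV.two_mul_card_zeroLayer_le hb.toIsFacetBasis
  rw [Fintype.card_fin] at hcard hzero
  obtain h | h | h : #(zeroLayer V b) = 0 ∨ #(zeroLayer V b) = 1 ∨ #(zeroLayer V b) = 2 := by omega
  · have := hV.card_negLayer_lt_of_zeroLayer_eq_empty hb (card_eq_zero.1 h)
    rw [Fintype.card_fin] at this
    omega
  · obtain ⟨x, hx⟩ := card_eq_one.1 h
    have := hV.card_negLayer_le_of_zeroLayer_eq_singleton hb hx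
    omega
  · obtain ⟨x, y, hxy, hZ⟩ := card_eq_two.1 h
    have := hV.card_negLayer_le_of_zeroLayer_eq_pair hb hxy hZ
    omega

end SplitPair

end FourDimensional

end Combinatorics

section Polytopes

variable {d : ℕ} {P F : Set (Fin d → ℝ)} {v w x : Fin d → ℝ}

namespace IsConvexPolytope

lemma finite_vertexSet (hP : IsConvexPolytope P) : (vertexSet P).Finite := by
  obtain ⟨S, hS, rfl⟩ := hP
  exact hS.subset extremePoints_convexHull_subset

lemma convex (hP : IsConvexPolytope P) : Convex ℝ P := by
  obtain ⟨S, -, rfl⟩ := hP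
  exact convex_convexHull ℝ S

lemma isCompact (hP : IsConvexPolytope P) : IsCompact P := by
  obtain ⟨S, hS, rfl⟩ := hP
  exact hS.isCompact_convexHull ℝ

lemma convexHull_vertexSet (hP : IsConvexPolytope P) : convexHull ℝ (vertexSet P) = P := by
  rw [← (hP.finite_vertexSet.isClosed_convexHull ℝ).closure_eq]
  exact closure_convexHull_extremePoints hP.isCompact hP.convex

lemma le_of_vertexSet (hP : IsConvexPolytope P) {f : (Fin d → ℝ) →L[ℝ] ℝ} {c : ℝ}
    (h : ∀ v ∈ vertexSet P, f v ≤ c) : ∀ x ∈ P, f x ≤ c := by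
  intro x hx
  rw [← hP.convexHull_vertexSet] at hx
  exact convexHull_min (t := {x | f x ≤ c}) h (convex_halfSpace_le f.isLinear c) hx

lemma valence_lt_ncard (hP : IsConvexPolytope P) (hv : v ∈ vertexSet P) :
    valence P v < (vertexSet P).ncard := by
  refine Set.ncard_lt_ncard ⟨fun w hw => hw.1, fun hsub => ?_⟩ hP.finite_vertexSet
  have hdim : faceDim (segment ℝ v v) = 1 := (hsub hv).2.2
  rw [segment_same, faceDim, vectorSpan_singleton, finrank_bot] at hdim
  exact zero_ne_one hdim

end IsConvexPolytope

lemma vertexSet_subset : vertexSet P ⊆ P := extremePoints_subset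

lemma notMem_interior_of_mem_vertexSet [NeZero d] (hv : v ∈ vertexSet P) : v ∉ interior P :=
  fun h => Set.disjoint_left.1 (disjoint_interior_extremePoints P) h hv

lemma eq_or_eq_of_mem_segment (hx : x ∈ vertexSet P) (hv : v ∈ P) (hw : w ∈ P)
    (h : x ∈ segment ℝ v w) : x = v ∨ x = w := by
  rcases (mem_extremePoints_iff_forall_segment.1 hx).2 v hv w hw h with h | h
  exacts [.inl h.symm, .inr h.symm]

lemma isFace_setOf_eq {f : (Fin d → ℝ) →L[ℝ] ℝ} {c : ℝ} (h : ∀ x ∈ P, f x ≤ c)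
    (hc : ∃ x ∈ P, f x = c) : IsFace P {x ∈ P | f x = c} := by
  obtain ⟨x, hx, hxc⟩ := hc
  refine ⟨⟨x, hx, hxc⟩, fun _ => ⟨f, Set.ext fun y => and_congr_right fun hy => ?_⟩⟩
  exact ⟨fun hyc z hz => hyc ▸ h z hz, fun hyc => (h y hy).antisymm (hxc ▸ hyc x hx)⟩

namespace IsFace

lemma vertexSet_eq (hF : IsFace P F) : vertexSet F = F ∩ vertexSet P :=
  hF.2.isExtreme.extremePoints_eq

lemma exists_functional (hF : IsFace P F) : ∃ (f : (Fin d → ℝ) →L[ℝ] ℝ) (c : ℝ),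
    (∀ x ∈ P, f x ≤ c) ∧ F = {x ∈ P | f x = c} := by
  obtain ⟨⟨x, hx⟩, hexp⟩ := hF
  obtain ⟨f, rfl⟩ := hexp ⟨x, hx⟩
  refine ⟨f, f x, hx.2, Set.ext fun y => and_congr_right fun hy => ?_⟩
  exact ⟨fun hyc => (hx.2 y hy).antisymm (hyc x hx.1), fun hyc z hz => hyc ▸ hx.2 z hz⟩

lemma mem_faceCone (hF : IsFace P F) (hv : v ∈ vertexSet P) (hvF : v ∈ F) : v ∈ faceCone F :=
  PointedCone.subset_hull (hF.vertexSet_eq ▸ ⟨hvF, hv⟩)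

end IsFace

lemma exists_smul_mem_convexHull_of_mem_hull {E : Type*} [AddCommGroup E] [Module ℝ E] {S : Set E}
    {v : E} (hv : v ∈ PointedCone.hull ℝ S) (hv0 : v ≠ 0) :
    ∃ r : ℝ, 0 < r ∧ ∃ y ∈ convexHull ℝ S, v = r • y := by
  obtain ⟨a, haS, ha, rfl⟩ := PointedCone.mem_hull_set.1 hv
  have hsum : 0 < ∑ u ∈ a.support, a u := by
    refine Finset.sum_pos (fun u hu => (ha u).lt_of_ne' (Finsupp.mem_support_iff.1 hu)) ?_
    rw [Finsupp.support_nonempty_iff]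
    rintro rfl
    exact hv0 Finsupp.sum_zero_index
  refine ⟨_, hsum, a.support.centerMass a id,
    a.support.centerMass_mem_convexHull (fun u _ => ha u) hsum haS, ?_⟩
  rw [Finset.centerMass, smul_inv_smul₀ hsum.ne']
  rfl

lemma functional_eq_zero_of_nonpos {E : Type*} [NormedAddCommGroup E] [NormedSpace ℝ E] {s : Set E}
    (h0 : 0 ∈ interior s) {f : E →L[ℝ] ℝ} (h : ∀ x ∈ s, f x ≤ 0) : f = 0 := by
  have hmax : IsLocalMax f 0 := by
    filter_upwards [mem_interior_iff_mem_nhds.1 h0] with x hx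
    simpa only [map_zero] using h x hx
  exact hmax.hasFDerivAt_eq_zero f.hasFDerivAt

lemma exists_functional_of_linearIndepOn {E : Type*} [AddCommGroup E] [Module ℝ E]
    [TopologicalSpace E] [IsTopologicalAddGroup E] [ContinuousSMul ℝ E] [T2Space E]
    [FiniteDimensional ℝ E] {s : Set E} (hs : LinearIndepOn ℝ id s) (φ : E → ℝ) :
    ∃ f : E →L[ℝ] ℝ, ∀ v ∈ s, f v = φ v := by
  let B := Module.Basis.extend hs
  refine ⟨LinearMap.toContinuousLinearMap (B.constr ℝ fun u => φ u), fun v hv => ?_⟩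
  have hBv : B ⟨v, hs.subset_extend _ hv⟩ = v := Module.Basis.extend_apply_self hs _
  conv_lhs => rw [← hBv]
  rw [LinearMap.coe_toContinuousLinearMap', Module.Basis.constr_basis]

lemma exists_pos_forall_mul_lt {α : Type*} {s : Set α} (hs : s.Finite) {a : α → ℝ}
    (ha : ∀ u ∈ s, 0 < a u) (b : α → ℝ) : ∃ t > 0, ∀ u ∈ s, t * b u < a u := by
  have hsmall : ∀ᶠ t : ℝ in nhds 0, ∀ u ∈ s, t * b u < a u := by
    refine (Filter.eventually_all_finite hs).2 fun u hu => ?_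
    have hcont : ContinuousAt (fun t : ℝ => t * b u) 0 := by fun_prop
    exact hcont.eventually_lt_const (by simpa only [zero_mul] using ha u hu)
  obtain ⟨t, ht, ht0⟩ := ((hsmall.filter_mono nhdsWithin_le_nhds).and
    (self_mem_nhdsWithin (s := Set.Ioi 0))).exists
  exact ⟨t, ht0, ht⟩

namespace IsFanoPolyhedron

lemma zero_mem (hP : IsFanoPolyhedron P) : (0 : Fin d → ℝ) ∈ P :=
  interior_subset hP.zero_mem_interior

lemma vertexSet_nonempty (hP : IsFanoPolyhedron P) : (vertexSet P).Nonempty := by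
  rw [← convexHull_nonempty_iff (𝕜 := ℝ), hP.isConvexPolytope.convexHull_vertexSet]
  exact ⟨0, hP.zero_mem⟩

lemma ne_zero_of_mem_vertexSet [NeZero d] (hP : IsFanoPolyhedron P) (hv : v ∈ vertexSet P) :
    v ≠ 0 := by
  rintro rfl
  exact notMem_interior_of_mem_vertexSet hv hP.zero_mem_interior

lemma exists_pos (hP : IsFanoPolyhedron P) {f : (Fin d → ℝ) →L[ℝ] ℝ} (hf : f ≠ 0) :
    ∃ v ∈ vertexSet P, 0 < f v := by
  by_contra! h
  exact hf (functional_eq_zero_of_nonpos hP.zero_mem_interior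
    (hP.isConvexPolytope.le_of_vertexSet h))

lemma isProperFace_setOf_eq (hP : IsFanoPolyhedron P) {f : (Fin d → ℝ) →L[ℝ] ℝ} {c : ℝ}
    (hc : 0 < c) (h : ∀ v ∈ vertexSet P, f v ≤ c) (hv : ∃ v ∈ vertexSet P, f v = c) :
    IsProperFace P {x ∈ P | f x = c} := by
  obtain ⟨v, hv, hvc⟩ := hv
  refine ⟨isFace_setOf_eq (hP.isConvexPolytope.le_of_vertexSet h)
    ⟨v, vertexSet_subset hv, hvc⟩, fun hF => hc.ne ?_⟩
  have h0 : (0 : Fin d → ℝ) ∈ {x ∈ P | f x = c} := hF.ge hP.zero_mem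
  simpa only [map_zero] using h0.2

lemma vertexSet_setOf_eq (hP : IsFanoPolyhedron P) {f : (Fin d → ℝ) →L[ℝ] ℝ} {c : ℝ}
    (hc : 0 < c) (h : ∀ v ∈ vertexSet P, f v ≤ c) (hv : ∃ v ∈ vertexSet P, f v = c) :
    vertexSet {x ∈ P | f x = c} = {v ∈ vertexSet P | f v = c} := by
  rw [(hP.isProperFace_setOf_eq hc h hv).1.vertexSet_eq]
  ext x
  exact ⟨fun hx => ⟨hx.2, hx.1.2⟩, fun hx => ⟨⟨vertexSet_subset hx.1, hx.2⟩, hx.1⟩⟩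

lemma exists_functional (hP : IsFanoPolyhedron P) (hF : IsProperFace P F) :
    ∃ (f : (Fin d → ℝ) →L[ℝ] ℝ) (c : ℝ), 0 < c ∧ (∀ x ∈ P, f x ≤ c) ∧
      F = {x ∈ P | f x = c} := by
  obtain ⟨f, c, hle, rfl⟩ := hF.1.exists_functional
  have hc : 0 ≤ c := by simpa only [map_zero] using hle 0 hP.zero_mem
  refine ⟨f, c, hc.lt_of_ne' fun hc0 => hF.2 ?_, hle, rfl⟩
  subst hc0
  rw [functional_eq_zero_of_nonpos hP.zero_mem_interior hle]
  simp only [zero_apply, and_true, Set.ofPred_mem_eq]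

lemma exists_isProperFace_of_vertex [NeZero d] (hP : IsFanoPolyhedron P)
    (hv : v ∈ vertexSet P) : ∃ F, IsProperFace P F ∧ v ∈ F := by
  obtain ⟨f, hf⟩ := geometric_hahn_banach_open_point hP.isConvexPolytope.convex.interior
    isOpen_interior (notMem_interior_of_mem_vertexSet hv)
  have hle : ∀ x ∈ P, f x ≤ f v := by
    intro x hx
    have hx' : x ∈ closure (interior P) := by
      rw [hP.isConvexPolytope.convex.closure_interior_eq_closure_of_nonempty_interior
        ⟨0, hP.zero_mem_interior⟩]
      exact subset_closure hx
    exact closure_minimal (t := {x | f x ≤ f v}) (fun y hy => (hf y hy).le)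
      (isClosed_le f.continuous continuous_const) hx'
  have hpos : 0 < f v := by simpa only [map_zero] using hf 0 hP.zero_mem_interior
  exact ⟨_, hP.isProperFace_setOf_eq hpos (fun x hx => hle x (vertexSet_subset hx)) ⟨v, hv, rfl⟩,
    vertexSet_subset hv, rfl⟩

lemma mem_of_mem_faceCone [NeZero d] (hP : IsFanoPolyhedron P) (hF : IsProperFace P F)
    (hv : v ∈ vertexSet P) (hvF : v ∈ faceCone F) : v ∈ F := by
  have hv0 := hP.ne_zero_of_mem_vertexSet hv
  obtain ⟨r, hr, y, hy, rfl⟩ := exists_smul_mem_convexHull_of_mem_hull hvF hv0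
  rw [← (hP.simplicial F hF).2] at hy
  obtain ⟨f, c, hc, hle, rfl⟩ := hP.exists_functional hF
  have hr1 : r ≤ 1 := by
    have hrc : r * c ≤ c := by
      simpa only [map_smul, hy.2, smul_eq_mul] using hle _ (vertexSet_subset hv)
    exact (mul_le_iff_le_one_left hc).1 hrc
  have hseg : r • y ∈ segment ℝ 0 y := ⟨1 - r, r, by linarith, hr.le, by ring, by simp⟩
  rw [(eq_or_eq_of_mem_segment hv hP.zero_mem hy.1 hseg).resolve_left hv0]
  exact hy

lemma linearIndepOn_vertexSet (hP : IsFanoPolyhedron P) (hF : IsProperFace P F) :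
    LinearIndepOn ℝ id (vertexSet F) := by
  obtain ⟨f, c, hc, -, hFeq⟩ := hP.exists_functional hF
  have hval : ∀ v : vertexSet F, f v = c := fun v => (hFeq ▸ vertexSet_subset v.2 :
    (v : Fin d → ℝ) ∈ {x ∈ P | f x = c}).2
  refine linearIndependent_iff'.2 fun s a ha => ?_
  have hsum := congrArg f ha
  simp only [map_sum, map_smul, map_zero, id_eq, hval, smul_eq_mul, ← Finset.sum_mul] at hsum
  exact affineIndependent_iff.1 (hP.simplicial F hF).1 s a
    ((mul_eq_zero.1 hsum).resolve_right hc.ne') ha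

/- The functional defining `F` is tilted by a small multiple of one that is `1` on `S` and `0` on
the other vertices of `F`. -/
lemma isProperFace_convexHull (hP : IsFanoPolyhedron P) (hF : IsProperFace P F)
    {S : Set (Fin d → ℝ)} (hSF : S ⊆ vertexSet F) (hS : S.Nonempty) :
    IsProperFace P (convexHull ℝ S) := by
  obtain ⟨g, hg⟩ := exists_functional_of_linearIndepOn (hP.linearIndepOn_vertexSet hF)
    (S.indicator 1)
  obtain ⟨f, c, hc, hle, rfl⟩ := hP.exists_functional hF
  have hvert := hF.1.vertexSet_eq
  obtain ⟨t, ht, htlt⟩ := exists_pos_forall_mul_lt (s := {u ∈ vertexSet P | f u < c})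
    (hP.isConvexPolytope.finite_vertexSet.subset fun u hu => hu.1) (a := fun u => c - f u)
    (fun u hu => sub_pos.2 hu.2) fun u => g u - 1
  have happly : ∀ u, (f + t • g) u = f u + t * g u := fun u => rfl
  have hgS : ∀ u ∈ S, g u = 1 := fun u hu => by
    rw [hg u (hSF hu), Set.indicator_of_mem hu, Pi.one_apply]
  have hSP : ∀ u ∈ S, u ∈ vertexSet P ∧ (f + t • g) u = c + t := fun u hu => by
    obtain ⟨⟨-, hfu⟩, huP⟩ := hvert ▸ hSF hu
    exact ⟨huP, by rw [happly, hfu, hgS u hu, mul_one]⟩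
  have hlt : ∀ u ∈ vertexSet P, u ∉ S → (f + t • g) u < c + t := by
    intro u hu huS
    rw [happly]
    rcases (hle u (vertexSet_subset hu)).lt_or_eq with hfu | hfu
    · linarith [htlt u ⟨hu, hfu⟩]
    · have huF : u ∈ vertexSet {x ∈ P | f x = c} := hvert ▸ ⟨⟨vertexSet_subset hu, hfu⟩, hu⟩
      rw [hg u huF, Set.indicator_of_notMem huS, hfu]
      linarith
  have hbound : ∀ u ∈ vertexSet P, (f + t • g) u ≤ c + t := fun u hu =>
    (em (u ∈ S)).elim (fun huS => (hSP u huS).2.le) fun huS => (hlt u hu huS).le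
  have hex : ∃ u ∈ vertexSet P, (f + t • g) u = c + t := hS.imp hSP
  have hG := hP.isProperFace_setOf_eq (by positivity) hbound hex
  have hGS : {u ∈ vertexSet P | (f + t • g) u = c + t} = S :=
    Set.Subset.antisymm (fun u hu => by_contra fun huS => (hlt u hu.1 huS).ne hu.2) hSP
  have hsimplex := (hP.simplicial _ hG).2
  rw [hP.vertexSet_setOf_eq (by positivity) hbound hex, hGS] at hsimplex
  exact hsimplex ▸ hG

lemma joinedByEdge_of_mem (hP : IsFanoPolyhedron P) (hF : IsProperFace P F)
    (hv : v ∈ vertexSet F) (hw : w ∈ vertexSet F) (hvw : v ≠ w) : JoinedByEdge P v w := by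
  have hface := hP.isProperFace_convexHull hF (Set.pair_subset hv hw) (Set.insert_nonempty v {w})
  rw [convexHull_pair] at hface
  refine ⟨hface.1, ?_⟩
  rw [faceDim, vectorSpan_segment]
  exact finrank_span_singleton (sub_ne_zero.2 hvw.symm)

lemma faceDim_self (hP : IsFanoPolyhedron P) : faceDim P = d := by
  have hspan : affineSpan ℝ P = ⊤ :=
    affineSpan_eq_top_of_nonempty_interior
      (hP.isConvexPolytope.convex.convexHull_eq.symm ▸ ⟨0, hP.zero_mem_interior⟩)
  rw [faceDim, AffineSubspace.vectorSpan_eq_top_of_affineSpan_eq_top _ _ _ hspan, finrank_top,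
    Module.finrank_fin_fun]

lemma isProperFace_segment (hd : d ≠ 1) (hP : IsFanoPolyhedron P) (h : JoinedByEdge P v w) :
    IsProperFace P (segment ℝ v w) :=
  ⟨h.1, fun h' => hd (by rw [← hP.faceDim_self, ← h', h.2])⟩

lemma exists_edge_functional (hd : d ≠ 1) (hP : IsFanoPolyhedron P) (hv : v ∈ vertexSet P)
    (hw : w ∈ vertexSet P) (h : JoinedByEdge P v w) :
    ∃ (f : (Fin d → ℝ) →L[ℝ] ℝ) (c : ℝ), 0 < c ∧ f v = c ∧ f w = c ∧
      ∀ x ∈ vertexSet P, f x ≤ c ∧ (f x = c → x = v ∨ x = w) := by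
  obtain ⟨f, c, hc, hle, hF⟩ := hP.exists_functional (hP.isProperFace_segment hd h)
  have hmem : ∀ x, x ∈ segment ℝ v w ↔ x ∈ P ∧ f x = c := fun x => by rw [hF]; rfl
  refine ⟨f, c, hc, ((hmem v).1 (left_mem_segment ℝ v w)).2,
    ((hmem w).1 (right_mem_segment ℝ v w)).2,
    fun x hx => ⟨hle x (vertexSet_subset hx), fun hxc => ?_⟩⟩
  exact eq_or_eq_of_mem_segment hx (vertexSet_subset hv) (vertexSet_subset hw)
    ((hmem x).2 ⟨vertexSet_subset hx, hxc⟩)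

lemma exists_mem_polyhedralFan_of_subset_singleton [NeZero d] (hP : IsFanoPolyhedron P)
    (hv : v ∈ vertexSet P) {D : Set (Fin d → ℝ)} (hD : D ⊆ {v}) :
    ∃ σ ∈ polyhedralFan P, D ⊆ (σ : Set (Fin d → ℝ)) := by
  obtain ⟨F, hF, hvF⟩ := hP.exists_isProperFace_of_vertex hv
  exact ⟨faceCone F, .inr ⟨F, hF, rfl⟩,
    hD.trans (Set.singleton_subset_iff.2 (hF.1.mem_faceCone hv hvF))⟩

lemma joinedByEdge_of_subset_cone [NeZero d] (hP : IsFanoPolyhedron P) (hv : v ∈ vertexSet P)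
    (hw : w ∈ vertexSet P) (hvw : v ≠ w) {σ : PointedCone ℝ (Fin d → ℝ)}
    (hσ : σ ∈ polyhedralFan P) (hsub : {v, w} ⊆ (σ : Set (Fin d → ℝ))) : JoinedByEdge P v w := by
  obtain ⟨hvσ, hwσ⟩ := Set.pair_subset_iff.1 hsub
  rcases hσ with rfl | ⟨F, hF, rfl⟩
  · exact absurd hvσ (hP.ne_zero_of_mem_vertexSet hv)
  · have hmem : ∀ u ∈ vertexSet P, u ∈ faceCone F → u ∈ vertexSet F := fun u hu huσ =>
      hF.1.vertexSet_eq ▸ ⟨hP.mem_of_mem_faceCone hF hu huσ, hu⟩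
    exact hP.joinedByEdge_of_mem hF (hmem v hv hvσ) (hmem w hw hwσ) hvw

lemma isPrimitiveCollection_pair_iff (hd : 2 ≤ d) (hP : IsFanoPolyhedron P)
    (hv : v ∈ vertexSet P) (hw : w ∈ vertexSet P) (hvw : v ≠ w) :
    IsPrimitiveCollection P {v, w} ↔ ¬ JoinedByEdge P v w := by
  have : NeZero d := ⟨by omega⟩
  refine ⟨fun hC hedge => ?_, fun hedge => ⟨Set.pair_subset hv hw,
    fun σ hσ hsub => hedge (hP.joinedByEdge_of_subset_cone hv hw hvw hσ hsub), fun D hD => ?_⟩⟩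
  · have hF := hP.isProperFace_segment (by omega) hedge
    exact hC.not_subset_cone _ (.inr ⟨_, hF, rfl⟩) (Set.pair_subset
      (hF.1.mem_faceCone hv (left_mem_segment ℝ v w))
      (hF.1.mem_faceCone hw (right_mem_segment ℝ v w)))
  · rcases Set.subset_pair_iff_eq.1 hD.subset with rfl | rfl | rfl | rfl
    · exact hP.exists_mem_polyhedralFan_of_subset_singleton hv (Set.empty_subset _)
    · exact hP.exists_mem_polyhedralFan_of_subset_singleton hv subset_rfl
    · exact hP.exists_mem_polyhedralFan_of_subset_singleton hw subset_rfl
    · exact absurd rfl hD.ne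

lemma exists_primitive_pair_iff (hd : 2 ≤ d) (hP : IsFanoPolyhedron P) :
    (∃ C, IsPrimitiveCollection P C ∧ C.ncard = 2) ↔ ¬ IsTwoNeighbourly P := by
  constructor
  · rintro ⟨C, hC, hcard⟩ hN
    obtain ⟨v, w, hvw, rfl⟩ := Set.ncard_eq_two.1 hcard
    obtain ⟨hv, hw⟩ := Set.pair_subset_iff.1 hC.subset_vertexSet
    exact (hP.isPrimitiveCollection_pair_iff hd hv hw hvw).1 hC (hN v hv w hw hvw)
  · intro hN
    simp only [IsTwoNeighbourly, not_forall] at hN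
    obtain ⟨v, hv, w, hw, hvw, hedge⟩ := hN
    exact ⟨{v, w}, (hP.isPrimitiveCollection_pair_iff hd hv hw hvw).2 hedge, Set.ncard_pair hvw⟩

end IsFanoPolyhedron

end Polytopes

section Lattice

open Module

lemma vectorSpan_eq_ker {K E : Type*} [Field K] [AddCommGroup E] [Module K E] {f : Dual K E}
    {s : Set E} (hs : s.Nonempty) (hf : ∀ x ∈ s, f x = 1)
    (hsep : ∀ g : Dual K E, (∀ x ∈ s, g x = 0) → g = 0) : vectorSpan K s = LinearMap.ker f := by
  apply le_antisymm
  · rw [vectorSpan_def, Submodule.span_le]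
    rintro _ ⟨x, hx, y, hy, rfl⟩
    simp [hf x hx, hf y hy]
  · intro x hx
    by_contra hxs
    obtain ⟨g, hgx, hg⟩ := Submodule.exists_le_ker_of_notMem hxs
    obtain ⟨y, hy⟩ := hs
    have hconst : ∀ z ∈ s, g z = g y := fun z hz =>
      sub_eq_zero.1 ((map_sub g z y).symm.trans (hg (vsub_mem_vectorSpan K hz hy)))
    have hgf : g - g y • f = 0 := hsep _ fun z hz => by simp [hf z hz, hconst z hz]
    exact hgx (by simpa [LinearMap.mem_ker.1 hx] using LinearMap.congr_fun hgf x)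

lemma exists_basis_coe_eq_of_isUnit_det {R n : Type*} [CommRing R] [Fintype n] [DecidableEq n]
    {v : n → n → R} (hv : IsUnit (Matrix.of v).det) : ∃ b : Basis n R (n → R), ⇑b = v := by
  obtain ⟨hli, hspan⟩ := (Basis.is_basis_iff_det (Pi.basisFun R n) (v := v)).2
    (by rwa [Pi.basisFun_det_apply])
  exact ⟨Basis.mk hli hspan.ge, Basis.coe_mk hli hspan.ge⟩

lemma exists_basis_coe_eq_of_range_subset {R ι M : Type*} [Semiring R] [AddCommMonoid M]
    [Module R M] [Finite ι] (b : Basis ι R M) {u : ι → M} (hu : Function.Injective u)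
    (hub : Set.range u ⊆ Set.range b) :
    ∃ b' : Basis ι R M, ⇑b' = u ∧ Set.range b' = Set.range b := by
  choose σ hσ using fun i => hub (Set.mem_range_self i)
  have hinj : Function.Injective σ := fun i j hij => hu (by rw [← hσ, ← hσ, hij])
  let e := Equiv.ofBijective σ (Finite.injective_iff_bijective.1 hinj)
  exact ⟨b.reindex e.symm, funext fun i => (b.reindex_apply e.symm i).trans (hσ i),
    b.range_reindex e.symm⟩

lemma injective_update {α β : Type*} [DecidableEq α] {f : α → β} (hf : Function.Injective f)
    {i : α} {y : β} (hy : ∀ j, j ≠ i → f j ≠ y) : Function.Injective (Function.update f i y) := by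
  intro j k hjk
  rcases eq_or_ne j i with rfl | hj <;> rcases eq_or_ne k j with rfl | hk
  · rfl
  · rw [Function.update_self, Function.update_of_ne hk] at hjk
    exact absurd hjk.symm (hy k hk)
  · rfl
  · rcases eq_or_ne k i with rfl | hki
    · rw [Function.update_self, Function.update_of_ne hj] at hjk
      exact absurd hjk (hy j hj)
    · rw [Function.update_of_ne hj, Function.update_of_ne hki] at hjk
      exact hf hjk

lemma exists_max_add_mul_eq {α : Type*} {s : Set α} (hs : s.Finite) {f g : α → ℝ} {c : ℝ}
    (hf : ∀ v ∈ s, f v ≤ c) (hg : ∃ v ∈ s, 0 < g v) :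
    ∃ t : ℝ, (∀ v ∈ s, f v + t * g v ≤ c) ∧ ∃ v ∈ s, 0 < g v ∧ f v + t * g v = c := by
  obtain ⟨v₀, hv₀⟩ := hg
  obtain ⟨v, ⟨hv, hgv⟩, hmin⟩ := Set.exists_min_image {v ∈ s | 0 < g v}
    (fun v => (c - f v) / g v) (hs.subset fun v hv => hv.1) ⟨v₀, hv₀⟩
  refine ⟨(c - f v) / g v, fun u hu => ?_, v, hv, hgv, ?_⟩
  · rcases lt_or_ge 0 (g u) with h | h
    · linarith [(le_div_iff₀ h).1 (hmin u ⟨hu, h⟩)]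
    · have ht : 0 ≤ (c - f v) / g v := div_nonneg (sub_nonneg.2 (hf v hv)) hgv.le
      linarith [mul_nonpos_of_nonneg_of_nonpos ht h, hf u hu]
  · rw [div_mul_cancel₀ _ hgv.ne', add_sub_cancel]

/-- The inclusion of `ℤ^d` into `ℝ^d`. -/
noncomputable def latticeEmbedding (d : ℕ) : (Fin d → ℤ) →ₗ[ℤ] (Fin d → ℝ) :=
  (Algebra.linearMap ℤ ℝ).compLeft (Fin d)

variable {d : ℕ} {P : Set (Fin d → ℝ)} {V : Finset (Fin d → ℤ)}
  {b : Basis (Fin d) ℤ (Fin d → ℤ)} {f : (Fin d → ℝ) →L[ℝ] ℝ}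

lemma latticeEmbedding_injective : Function.Injective (latticeEmbedding d) :=
  Function.Injective.comp_left (g := ((↑) : ℤ → ℝ)) Int.cast_injective

lemma isBaseChange_latticeEmbedding : IsBaseChange ℝ (latticeEmbedding d) :=
  (IsBaseChange.linearMap ℤ ℝ).finitePow (Fin d)

lemma exists_functional_extending (φ : (Fin d → ℤ) →ₗ[ℤ] ℤ) :
    ∃ f : (Fin d → ℝ) →L[ℝ] ℝ, ∀ z, f (latticeEmbedding d z) = φ z :=
  ⟨LinearMap.toContinuousLinearMap
      (isBaseChange_latticeEmbedding.lift ((Algebra.linearMap ℤ ℝ).comp φ)),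
    isBaseChange_latticeEmbedding.lift_eq _⟩

lemma functional_latticeEmbedding (b : Basis (Fin d) ℤ (Fin d → ℤ)) (f : (Fin d → ℝ) →L[ℝ] ℝ)
    (z : Fin d → ℤ) :
    f (latticeEmbedding d z) = ∑ i, b.repr z i * f (latticeEmbedding d (b i)) := by
  conv_lhs => rw [← b.sum_repr z, map_sum, map_sum]
  refine Finset.sum_congr rfl fun i _ => ?_
  rw [map_smul, ← Int.cast_smul_eq_zsmul ℝ, map_smul, smul_eq_mul]

lemma functional_eq_zero_of_basis (hf : ∀ i, f (latticeEmbedding d (b i)) = 0) : f = 0 := by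
  have hz (z : Fin d → ℤ) : f (latticeEmbedding d z) = 0 := by
    rw [functional_latticeEmbedding b]
    simp only [hf, mul_zero, Finset.sum_const_zero]
  exact ContinuousLinearMap.coe_injective (isBaseChange_latticeEmbedding.algHom_ext _ 0 hz)

lemma isFacetBasis_of_range_eq (hle : ∀ z ∈ V, f (latticeEmbedding d z) ≤ 1)
    (hb : Set.range b = {z | z ∈ V ∧ f (latticeEmbedding d z) = 1}) : IsFacetBasis V b := by
  have hbV : ∀ i, b i ∈ V ∧ f (latticeEmbedding d (b i)) = 1 := Set.range_subset_iff.1 hb.subset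
  refine ⟨fun i => (hbV i).1, fun z hz hzb => ?_⟩
  have hheight : f (latticeEmbedding d z) = height b z := by
    rw [functional_latticeEmbedding b, height_apply, Int.cast_sum]
    simp only [(hbV _).2, mul_one]
  have hlt : f (latticeEmbedding d z) < 1 := (hle z hz).lt_of_ne fun hz1 => by
    obtain ⟨i, hi⟩ := hb.superset ⟨hz, hz1⟩
    exact hzb i hi.symm
  rw [hheight] at hlt
  exact Int.lt_add_one_iff.1 (by exact_mod_cast hlt)

namespace IsFanoPolyhedron

lemma exists_finset_image_latticeEmbedding (hP : IsFanoPolyhedron P) :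
    ∃ V : Finset (Fin d → ℤ), latticeEmbedding d '' V = vertexSet P := by
  have hrange : vertexSet P ⊆ Set.range (latticeEmbedding d) := fun v hv => by
    obtain ⟨z, rfl⟩ := hP.vertex_integral v hv
    exact ⟨z, rfl⟩
  have hfin := hP.isConvexPolytope.finite_vertexSet.preimage
    (latticeEmbedding_injective (d := d)).injOn
  exact ⟨hfin.toFinset, by rw [hfin.coe_toFinset, Set.image_preimage_eq_of_subset hrange]⟩

lemma exists_pos_latticeEmbedding (hP : IsFanoPolyhedron P)
    (hV : latticeEmbedding d '' V = vertexSet P) (hf : f ≠ 0) :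
    ∃ z ∈ V, 0 < f (latticeEmbedding d z) := by
  simpa only [← hV, Set.exists_mem_image, Finset.mem_coe] using hP.exists_pos hf

lemma exists_basis_range_eq [NeZero d] (hP : IsFanoPolyhedron P)
    (hV : latticeEmbedding d '' V = vertexSet P) (hle : ∀ z ∈ V, f (latticeEmbedding d z) ≤ 1)
    (hsep : ∀ g : (Fin d → ℝ) →L[ℝ] ℝ, (∀ z ∈ V, f (latticeEmbedding d z) = 1 →
      g (latticeEmbedding d z) = 0) → g = 0) :
    ∃ b : Basis (Fin d) ℤ (Fin d → ℤ),
      Set.range b = {z | z ∈ V ∧ f (latticeEmbedding d z) = 1} := by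
  obtain ⟨z₀, hz₀, hz₀1⟩ : ∃ z ∈ V, f (latticeEmbedding d z) = 1 := by
    by_contra! h
    have hproj := hsep (ContinuousLinearMap.proj 0) fun z hz hz1 => absurd hz1 (h z hz)
    simpa using DFunLike.congr_fun hproj (Pi.single 0 1)
  have hVP : ∀ z ∈ V, latticeEmbedding d z ∈ vertexSet P := fun z hz => hV ▸ ⟨z, hz, rfl⟩
  have hleP : ∀ v ∈ vertexSet P, f v ≤ 1 := hV ▸ Set.forall_mem_image.2 hle
  have hex : ∃ v ∈ vertexSet P, f v = 1 := ⟨_, hVP z₀ hz₀, hz₀1⟩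
  have hspan : vectorSpan ℝ {x ∈ P | f x = 1} = LinearMap.ker (f : (Fin d → ℝ) →ₗ[ℝ] ℝ) := by
    refine vectorSpan_eq_ker ⟨_, vertexSet_subset (hVP z₀ hz₀), hz₀1⟩ (fun x hx => hx.2)
      fun g hg => ?_
    have hg0 := hsep (LinearMap.toContinuousLinearMap g) fun z hz hz1 =>
      hg _ ⟨vertexSet_subset (hVP z hz), hz1⟩
    exact LinearMap.toContinuousLinearMap.map_eq_zero_iff.1 hg0
  have hf0 : (f : (Fin d → ℝ) →ₗ[ℝ] ℝ) ≠ 0 := fun h =>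
    one_ne_zero (hz₀1.symm.trans (LinearMap.congr_fun h _))
  obtain ⟨A, hA, hrange⟩ := hP.facet_basis _ (hP.isProperFace_setOf_eq one_pos hleP hex) (by
    rw [faceDim, hspan, Module.Dual.finrank_ker_add_one_of_ne_zero hf0, Module.finrank_fin_fun])
  obtain ⟨b, hb⟩ := exists_basis_coe_eq_of_isUnit_det (v := A) (Int.isUnit_iff.2 hA)
  refine ⟨b, latticeEmbedding_injective.image_injective ?_⟩
  rw [← Set.range_comp, hb]
  refine (hrange.symm.trans (hP.vertexSet_setOf_eq one_pos hleP hex)).trans ?_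
  rw [← hV]
  exact Set.image_inter_preimage _ _ {v | f v = 1} |>.symm

/- A functional bounded by `1` on the vertices is moved so as to attain `1` at more of them until
its level set `1` spans a facet. -/
lemma exists_isFacetBasis [NeZero d] (hP : IsFanoPolyhedron P)
    (hV : latticeEmbedding d '' V = vertexSet P) :
    ∃ b : Basis (Fin d) ℤ (Fin d → ℤ), IsFacetBasis V b := by
  let levelSet : ((Fin d → ℝ) →L[ℝ] ℝ) → Set (Fin d → ℤ) :=
    fun f => {z | z ∈ V ∧ f (latticeEmbedding d z) = 1}
  let levelSets := levelSet '' {f | ∀ z ∈ V, f (latticeEmbedding d z) ≤ 1}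
  have hfin : levelSets.Finite := V.finite_toSet.finite_subsets.subset
    (Set.image_subset_iff.2 fun f _ z hz => hz.1)
  have hne : levelSets.Nonempty := ⟨_, 0, fun z _ => by simp, rfl⟩
  obtain ⟨_, ⟨f, hf, rfl⟩, hmax⟩ := hfin.exists_maximal hne
  obtain ⟨b, hb⟩ := hP.exists_basis_range_eq hV hf fun g hg => by
    by_contra hg0
    obtain ⟨t, hle, z, hz, hgz, hz1⟩ := exists_max_add_mul_eq V.finite_toSet hf
      (hP.exists_pos_latticeEmbedding hV hg0)
    have hsub : levelSet f ⊆ levelSet (f + t • g) := fun x ⟨hx, hx1⟩ =>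
      ⟨hx, by simp [hx1, hg x hx hx1]⟩
    have hzf : z ∈ levelSet f := hmax ⟨f + t • g, hle, rfl⟩ hsub ⟨hz, hz1⟩
    exact hgz.ne' (hg z hz hzf.2)
  exact ⟨b, isFacetBasis_of_range_eq hf hb⟩

lemma exists_rotated_functional (hP : IsFanoPolyhedron P)
    (hV : latticeEmbedding d '' V = vertexSet P) (hb : IsFacetBasis V b) (i : Fin d) :
    ∃ f : (Fin d → ℝ) →L[ℝ] ℝ, (∀ z ∈ V, f (latticeEmbedding d z) ≤ 1) ∧
      (∀ j, j ≠ i → f (latticeEmbedding d (b j)) = 1) ∧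
      ∃ z ∈ V, b.repr z i < 0 ∧ f (latticeEmbedding d z) = 1 := by
  obtain ⟨f, hf⟩ := exists_functional_extending (height b)
  obtain ⟨g, hg⟩ := exists_functional_extending (-b.coord i)
  have hg0 : g ≠ 0 := by
    rintro rfl
    simpa using hg (b i)
  have hf1 : ∀ z ∈ (V : Set (Fin d → ℤ)), f (latticeEmbedding d z) ≤ 1 := fun z hz => by
    rw [hf]
    exact_mod_cast hb.height_le_one hz
  obtain ⟨t, hle, z, hz, hgz, hz1⟩ := exists_max_add_mul_eq V.finite_toSet hf1
    (hP.exists_pos_latticeEmbedding hV hg0)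
  refine ⟨f + t • g, hle, fun j hj => ?_, z, hz, ?_, hz1⟩
  · simp [hf, hg, hj.symm]
  · simpa [hg] using hgz

lemma exists_isAdjacent [NeZero d] (hP : IsFanoPolyhedron P)
    (hV : latticeEmbedding d '' V = vertexSet P) (hb : IsFacetBasis V b) (i : Fin d) :
    ∃ b', IsAdjacent V b b' i := by
  obtain ⟨f, hle, hfb, z, hz, hzi, hz1⟩ := hP.exists_rotated_functional hV hb i
  obtain ⟨c, hc⟩ := hP.exists_basis_range_eq hV hle fun g hg => by
    have hgb : ∀ j, j ≠ i → g (latticeEmbedding d (b j)) = 0 := fun j hj =>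
      hg _ (hb.mem j) (hfb j hj)
    have hgz : b.repr z i * g (latticeEmbedding d (b i)) = 0 := by
      rw [← hg z hz hz1, functional_latticeEmbedding b g z, Finset.sum_eq_single i
        (fun j _ hj => by rw [hgb j hj, mul_zero]) (by simp)]
    refine functional_eq_zero_of_basis (b := b) fun j => ?_
    rcases eq_or_ne j i with rfl | hj
    · exact (mul_eq_zero.1 hgz).resolve_left (Int.cast_ne_zero.2 hzi.ne)
    · exact hgb j hj
  have hzb : ∀ j, b j ≠ z := by
    rintro j rfl
    rw [b.repr_self] at hzi
    exact hzi.not_ge (Finsupp.single_nonneg.2 zero_le_one i)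
  have hrange : Set.range (Function.update b i z) ⊆ Set.range c := by
    rw [hc, Set.range_subset_iff]
    intro j
    rcases eq_or_ne j i with rfl | hj
    · rw [Function.update_self]
      exact ⟨hz, hz1⟩
    · rw [Function.update_of_ne hj]
      exact ⟨hb.mem j, hfb j hj⟩
  obtain ⟨b', hb', hb'c⟩ := exists_basis_coe_eq_of_range_subset c
    (injective_update b.injective (i := i) fun j _ => hzb j) hrange
  exact ⟨b', hb, isFacetBasis_of_range_eq hle (hb'c.trans hc),
    by rw [hb', Function.update_self]; exact (hzb i).symm,
    fun j hj => by rw [hb', Function.update_of_ne hj]⟩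

lemma isNeighbourlyConfig (hd : 2 ≤ d) (hP : IsFanoPolyhedron P) (hN : IsTwoNeighbourly P)
    (hV : latticeEmbedding d '' V = vertexSet P) : IsNeighbourlyConfig (Fin d) V where
  exists_facetBasis :=
    have : NeZero d := ⟨by omega⟩
    hP.exists_isFacetBasis hV
  exists_adjacent b hb i :=
    have : NeZero d := ⟨by omega⟩
    hP.exists_isAdjacent hV hb i
  exists_edge v hv w hw hvw := by
    have hVP : ∀ z ∈ V, latticeEmbedding d z ∈ vertexSet P := fun z hz => hV ▸ ⟨z, hz, rfl⟩
    have hedge := hN _ (hVP v hv) _ (hVP w hw) (latticeEmbedding_injective.ne hvw)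
    obtain ⟨f, c, hc, hfv, hfw, hle⟩ :=
      hP.exists_edge_functional (by omega) (hVP v hv) (hVP w hw) hedge
    refine ⟨(f : (Fin d → ℝ) →+ ℝ).comp (latticeEmbedding d).toAddMonoidHom, c, hc, hfv, hfw,
      fun x hx => ⟨(hle _ (hVP x hx)).1, fun hxc => ?_⟩⟩
    exact ((hle _ (hVP x hx)).2 hxc).imp (fun h => latticeEmbedding_injective h)
      fun h => latticeEmbedding_injective h

lemma ncard_vertexSet_le_seven {P : Set (Fin 4 → ℝ)} (hP : IsFanoPolyhedron P)
    (hN : IsTwoNeighbourly P) : (vertexSet P).ncard ≤ 7 := by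
  obtain ⟨V, hV⟩ := hP.exists_finset_image_latticeEmbedding
  rw [← hV, Set.ncard_image_of_injective _ latticeEmbedding_injective, Set.ncard_coe_finset]
  exact (hP.isNeighbourlyConfig (by norm_num) hN hV).card_le_seven

end IsFanoPolyhedron

end Lattice

theorem mainTheorem7_general (P : Set (Fin 4 → ℝ)) (hP : IsFanoPolyhedron P) :
    (7 < (vertexSet P).ncard →
      (∃ C, IsPrimitiveCollection P C ∧ C.ncard = 2) ∧ ¬ IsTwoNeighbourly P) ∧
    ((∃ C, IsPrimitiveCollection P C ∧ C.ncard = 2) ↔ ¬ IsTwoNeighbourly P) := by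
  have hiff := hP.exists_primitive_pair_iff (by norm_num)
  refine ⟨fun hcard => ?_, hiff⟩
  have hN : ¬ IsTwoNeighbourly P := fun hN => hcard.not_ge (hP.ncard_vertexSet_le_seven hN)
  exact ⟨hiff.2 hN, hN⟩

theorem mainTheorem7 (P : Set (Fin 4 → ℝ)) (hP : IsFanoPolyhedron P) :
    ((∀ v ∈ vertexSet P, 7 ≤ valence P v) →
      (∃ C, IsPrimitiveCollection P C ∧ C.ncard = 2) ∧ ¬ IsTwoNeighbourly P) ∧
    ((∃ C, IsPrimitiveCollection P C ∧ C.ncard = 2) ↔ ¬ IsTwoNeighbourly P) := by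
  obtain ⟨v, hv⟩ := hP.vertexSet_nonempty
  exact (mainTheorem7_general P hP).imp_left fun h hval =>
    h ((hval v hv).trans_lt (hP.isConvexPolytope.valence_lt_ncard hv))
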